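/- Let $d\ge 1$, $p\in[1,\infty]$, and let $f_0$ be a probability density on $\mathbb R^d\times\mathbb R^d$ with $f_0\in L^p(\mathbb R^d\times\mathbb R^d)$ and finite first velocity moment $$\int_{\mathbb R^d}\int_{\mathbb R^d} f_0(x,w)\,|w|\,\mathrm dx\,\mathrm dw<\infty .$$ Let $f\in C([0,\infty);L^1(\mathbb R^d\times\mathbb R^d))$ be the (weak) solution of the kinetic Fokker–Planck equation $$\partial_t f+v\cdot\nabla_x f=\Delta_v f+\operatorname{div}_v(vf),\qquad f(0,\cdot,\cdot)=f_0,$$ and let $u\in C([0,\infty);L^1(\mathbb R^d))$ be the (weak) solution of the heat equation $$\partial_t u=\Delta u,\qquad u(0,x)=\int_{\mathbb R^d}f_0(x,w)\,\mathrm dw .$$ Let $\mathcal M(v)=(2\pi)^{-d/2}e^{-|v|^2/2}$. Then for every $t_0>0$ there is a constant $C>0$, depending only on $d$, $p$, $t_0$ and on upper bounds for $\|f_0\|_{L^p(\mathbb R^d\times\mathbb R^d)}$ and for the first velocity moment of $f_0$, such that for all $t\ge t_0$ $$\|f(t,x,v)-u(t,x)\mathcal M(v)\|_{L^p_xL^1_v}\le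 C\,t^{-\frac d2\left(1-\frac1p\right)}\,t^{-\frac12},$$ where $\|g\|_{L^p_xL^1_v}$ denotes the $L^p(\mathbb R^d)$ norm of $x\mapsto\int_{\mathbb R^d}|g(x,v)|\,\mathrm dv$. -/

import Mathlib

open MeasureTheory Filter Topology
open scoped ENNReal NNReal ContDiff

/-- The mixed Lebesgue norm of `L^p_x L^r_v`: the `L^p` norm in `x` of the `L^r` norm in `v`. -/
noncomputable def mixedNorm {d : ℕ} (p r : ℝ≥0∞)
    (g : EuclideanSpace ℝ (Fin d) × EuclideanSpace ℝ (Fin d) → ℝ) : ℝ≥0∞ :=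
  eLpNorm (fun x => eLpNorm (fun v => g (x, v)) r volume) p volume

/-- The standard Gaussian density `𝓜(v) = (2π)^{-d/2} exp(-|v|²/2)`. -/
noncomputable def maxwellian {d : ℕ} (v : EuclideanSpace ℝ (Fin d)) : ℝ :=
  (2 * Real.pi) ^ (-(d : ℝ) / 2) * Real.exp (-‖v‖ ^ 2 / 2)

/-- `f₀` is a probability density on the phase space. -/
structure IsProbabilityDensity {α : Type*} [MeasureSpace α] (f₀ : α → ℝ) : Prop where
  nonneg : ∀ᵐ z, 0 ≤ f₀ z
  integrable : Integrable f₀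
  integral_eq_one : ∫ z, f₀ z = 1

/-- The curve `t ↦ f t` belongs to `C([0,∞); L¹)`. -/
structure IsContinuousL1Curve {α : Type*} [MeasureSpace α] (f : ℝ → α → ℝ) : Prop where
  integrable : ∀ t, 0 ≤ t → Integrable (f t)
  continuous : ∀ s, 0 ≤ s →
    Tendsto (fun t => eLpNorm (fun z => f t z - f s z) 1 volume) (𝓝[Set.Ici 0] s) (𝓝 0)

/-- The formal adjoint of the kinetic Fokker–Planck operator
`f ↦ -v·∇ₓf + Δᵥf + divᵥ(v f)`, namely `φ ↦ v·∇ₓφ + Δᵥφ - v·∇ᵥφ`. -/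
noncomputable def kfpAdjoint {d : ℕ}
    (φ : EuclideanSpace ℝ (Fin d) × EuclideanSpace ℝ (Fin d) → ℝ)
    (z : EuclideanSpace ℝ (Fin d) × EuclideanSpace ℝ (Fin d)) : ℝ :=
  fderiv ℝ φ z (z.2, 0) + Laplacian.laplacian (fun v => φ (z.1, v)) z.2 - fderiv ℝ φ z (0, z.2)

/-- `f ∈ C([0,∞); L¹(ℝᵈ × ℝᵈ))` is the (weak, i.e. distributional) solution of
`∂ₜf + v·∇ₓf = Δᵥf + divᵥ(v f)` with initial datum `f₀`. -/
structure IsKFPSolution {d : ℕ}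
    (f₀ : EuclideanSpace ℝ (Fin d) × EuclideanSpace ℝ (Fin d) → ℝ)
    (f : ℝ → EuclideanSpace ℝ (Fin d) × EuclideanSpace ℝ (Fin d) → ℝ) : Prop where
  curve : IsContinuousL1Curve f
  initial : f 0 =ᵐ[volume] f₀
  weak : ∀ φ : EuclideanSpace ℝ (Fin d) × EuclideanSpace ℝ (Fin d) → ℝ,
    ContDiff ℝ ∞ φ → HasCompactSupport φ → ∀ t, 0 ≤ t →
      ∫ z, f t z * φ z = (∫ z, f₀ z * φ z) + ∫ s in (0 : ℝ)..t, ∫ z, f s z * kfpAdjoint φ z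

/-- `u ∈ C([0,∞); L¹(ℝᵈ))` is the (weak, i.e. distributional) solution of the heat equation
`∂ₜu = Δu` with initial datum `u₀`. -/
structure IsHeatSolution {d : ℕ} (u₀ : EuclideanSpace ℝ (Fin d) → ℝ)
    (u : ℝ → EuclideanSpace ℝ (Fin d) → ℝ) : Prop where
  curve : IsContinuousL1Curve u
  initial : u 0 =ᵐ[volume] u₀
  weak : ∀ φ : EuclideanSpace ℝ (Fin d) → ℝ,
    ContDiff ℝ ∞ φ → HasCompactSupport φ → ∀ t, 0 ≤ t →
      ∫ x, u t x * φ x =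
        (∫ x, u₀ x * φ x) + ∫ s in (0 : ℝ)..t, ∫ x, u s x * Laplacian.laplacian φ x

/-! Both solutions are superpositions of explicit Gaussian kernels, so the estimate reduces to
comparing two Gaussians for one fixed initial state $(y,w)$. For the kinetic equation the velocity
at time $t$ has mean $e^{-t}w$ and variance $1-e^{-2t}$ per direction. Given the final velocity $v$,
the position has mean $y+\tanh(t/2)(v+w)$ and variance $2(t-2\tanh(t/2))$. The limit profile has
mean $y$ and variance $2t$ in position, and mean $0$ and variance $1$ in velocity.

For $t\ge t_0$ the position variance is comparable to $t$. Measured in standard deviations, the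
position mean is then off by $O((|v|+|w|)t^{-1/2})$, the relative variance error is $O(1/t)$, and
the velocity laws are exponentially close up to a factor $1+|w|$. A factor $|v-e^{-t}w|$ is absorbed
by doubling the variance of the velocity Gaussian. Hence the kernels differ by $O((1+|w|)t^{-1/2})$
in $L^1_xL^1_v$, and with an extra $t^{-d/2}$ in $L^\infty_xL^1_v$
(`exists_lintegral_kernel_sub_le`). Averaging against $f_0$ costs its mass and first velocity
moment, and interpolation between $L^1$ and $L^\infty$ gives the rate
(`mixedNorm_one_le_of_ae_eq_integral_kernel`).

The solutions are only weak and $L^1$, so the kernel representation is proved on the Fourier side.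
The pairing of $f(s)$ with $a(s)\cos(l_s(z)+\theta)$ is constant in $s$ when $l_s$ follows the dual
characteristics $\dot l=-l\circ B$ and $a$ compensates the diffusive damping
(`IsContinuousL1Curve.integral_mul_cos_eq`). This determines the Fourier transform at each time; the
kernels have the same one, and an integrable function is determined by its transform
(`sub_maxwellian_ae_eq_integral_kernel`). -/

/-! ### Pairings of continuous $L^1$ curves with bounded functions -/

section L1Curves

/-- The pairing of `L¹` functions with bounded functions is continuous along `L¹` convergence and
bounded pointwise convergence. -/
lemma tendsto_integral_mul_of_tendsto_eLpNorm {α ι : Type*} [MeasurableSpace α] {μ : Measure α}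
    {l : Filter ι} [l.IsCountablyGenerated] {f : ι → α → ℝ} {f₁ : α → ℝ} {q : ι → α → ℝ}
    {q₁ : α → ℝ} {K : ℝ} (hf : ∀ᶠ i in l, Integrable (f i) μ) (hf₁ : Integrable f₁ μ)
    (hlim : Tendsto (fun i => eLpNorm (fun z => f i z - f₁ z) 1 μ) l (𝓝 0))
    (hq : ∀ᶠ i in l, AEStronglyMeasurable (q i) μ) (hK : ∀ᶠ i in l, ∀ z, |q i z| ≤ K)
    (hqlim : ∀ z, Tendsto (fun i => q i z) l (𝓝 (q₁ z))) :
    Tendsto (fun i => ∫ z, f i z * q i z ∂μ) l (𝓝 (∫ z, f₁ z * q₁ z ∂μ)) := by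
  have h1 : Tendsto (fun i => ∫ z, f₁ z * q i z ∂μ) l (𝓝 (∫ z, f₁ z * q₁ z ∂μ)) := by
    refine tendsto_integral_filter_of_dominated_convergence (fun z => |f₁ z| * K) ?_ ?_
      (hf₁.abs.mul_const K) (ae_of_all _ fun z => (hqlim z).const_mul _)
    · filter_upwards [hq] with i hi using hf₁.aestronglyMeasurable.mul hi
    · filter_upwards [hK] with i hi
      refine ae_of_all _ fun z => ?_
      rw [Real.norm_eq_abs, abs_mul]
      exact mul_le_mul_of_nonneg_left (hi z) (abs_nonneg _)
  have h2 : Tendsto (fun i => ∫ z, (f i z - f₁ z) * q i z ∂μ) l (𝓝 0) := by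
    have h3 : Tendsto (fun i => (eLpNorm (fun z => f i z - f₁ z) 1 μ).toReal * K) l (𝓝 0) := by
      simpa using ((ENNReal.tendsto_toReal ENNReal.zero_ne_top).comp hlim).mul_const K
    refine squeeze_zero_norm' ?_ h3
    filter_upwards [hf, hq, hK] with i hi hqi hKi
    have hd : Integrable (fun z => f i z - f₁ z) μ := hi.sub hf₁
    rw [eLpNorm_one_eq_lintegral_enorm, ← integral_norm_eq_lintegral_enorm hd.aestronglyMeasurable,
      ← integral_mul_const]
    refine norm_integral_le_of_norm_le (hd.norm.mul_const K) (ae_of_all _ fun z => ?_)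
    rw [norm_mul]
    exact mul_le_mul_of_nonneg_left (hKi z) (norm_nonneg _)
  have h4 := h2.add h1
  rw [zero_add] at h4
  refine h4.congr' ?_
  filter_upwards [hf, hq, hK] with i hi hqi hKi
  rw [← integral_add]
  · exact integral_congr_ae (ae_of_all _ fun z => by ring)
  · exact (hi.sub hf₁).mul_bdd (c := K) hqi (ae_of_all _ hKi)
  · exact hf₁.mul_bdd (c := K) hqi (ae_of_all _ hKi)

variable {α : Type*} [MeasureSpace α] {f : ℝ → α → ℝ}

lemma IsContinuousL1Curve.continuousWithinAt_integral_mul (hf : IsContinuousL1Curve f) {s : ℝ}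
    (hs : 0 ≤ s) {q : ℝ → α → ℝ} {K : ℝ} (hq : ∀ t, AEStronglyMeasurable (q t))
    (hK : ∀ᶠ t in 𝓝 s, ∀ z, |q t z| ≤ K) (hqc : ∀ z, ContinuousAt (fun t => q t z) s) :
    ContinuousWithinAt (fun t => ∫ z, f t z * q t z) (Set.Ici 0) s :=
  tendsto_integral_mul_of_tendsto_eLpNorm
    (by filter_upwards [self_mem_nhdsWithin] with t ht using hf.integrable t ht)
    (hf.integrable s hs) (hf.continuous s hs) (Eventually.of_forall hq)
    (hK.filter_mono nhdsWithin_le_nhds) (fun z => (hqc z).tendsto.mono_left nhdsWithin_le_nhds)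

/-- A product rule in which `f` is differentiable only against the frozen test function `q s`. The
other half of the difference quotient, $f_t\,(q_t-q_s)/(t-s)$, needs only $L^1$ continuity of `f`,
since the mean value inequality bounds the slopes of `q` uniformly. -/
lemma IsContinuousL1Curve.hasDerivAt_integral_mul (hf : IsContinuousL1Curve f) {s : ℝ}
    (hs : 0 < s) {q q' : ℝ → α → ℝ} {K m : ℝ} (hq : ∀ t, AEStronglyMeasurable (q t))
    (hb : ∀ t, 0 ≤ t → ∃ b, ∀ z, |q t z| ≤ b)
    (hd : ∀ t z, HasDerivAt (fun t => q t z) (q' t z) t)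
    (hK : ∀ t ∈ Set.Icc 0 (s + 1), ∀ z, |q' t z| ≤ K)
    (hm : HasDerivAt (fun t => ∫ z, f t z * q s z) m s) :
    HasDerivAt (fun t => ∫ z, f t z * q t z) (m + ∫ z, f s z * q' s z) s := by
  have hnear : ∀ᶠ t in 𝓝[≠] s, t ∈ Set.Ioo 0 (s + 1) :=
    nhdsWithin_le_nhds (Ioo_mem_nhds hs (by linarith))
  have hle : 𝓝[≠] s ≤ 𝓝[Set.Ici 0] s := by
    have : 𝓝[Set.Ici 0] s = 𝓝 s := nhdsWithin_eq_nhds.2 (Ici_mem_nhds hs)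
    rw [this]
    exact nhdsWithin_le_nhds
  have h1 : Tendsto (fun t => ∫ z, f t z * slope (fun r => q r z) s t) (𝓝[≠] s)
      (𝓝 (∫ z, f s z * q' s z)) := by
    refine tendsto_integral_mul_of_tendsto_eLpNorm (K := K)
      (by filter_upwards [hnear] with t ht using hf.integrable t ht.1.le)
      (hf.integrable s hs.le) ((hf.continuous s hs.le).mono_left hle) ?_ ?_ ?_
    · refine Eventually.of_forall fun t => ?_
      simp only [slope_def_field, div_eq_mul_inv]
      exact ((hq t).sub (hq s)).mul_const _
    · filter_upwards [hnear, self_mem_nhdsWithin] with t ht hne z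
      have hlip := (convex_Icc (0 : ℝ) (s + 1)).norm_image_sub_le_of_norm_hasDerivWithin_le
        (f := fun r => q r z) (fun r _ => (hd r z).hasDerivWithinAt) (fun r hr => hK r hr z)
        ⟨hs.le, by linarith⟩ ⟨ht.1.le, ht.2.le⟩
      have hpos : 0 < |t - s| := abs_pos.2 (sub_ne_zero.2 hne)
      rw [slope_def_field, abs_div, div_le_iff₀ hpos]
      exact hlip
    · exact fun z => hasDerivAt_iff_tendsto_slope.1 (hd s z)
  rw [hasDerivAt_iff_tendsto_slope] at hm ⊢
  refine (hm.add h1).congr' ?_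
  filter_upwards [hnear] with t ht
  have hint : ∀ r r', 0 ≤ r → 0 ≤ r' → Integrable fun z => f r z * q r' z := fun r r' hr hr' => by
    obtain ⟨b, hb⟩ := hb r' hr'
    exact (hf.integrable r hr).mul_bdd (c := b) (hq r') (ae_of_all _ hb)
  simp only [slope_def_field]
  rw [← integral_sub (hint t s ht.1.le hs.le) (hint s s hs.le hs.le),
    ← integral_sub (hint t t ht.1.le ht.1.le) (hint s s hs.le hs.le), ← integral_div,
    ← integral_div, ← integral_add]
  · exact integral_congr_ae (ae_of_all _ fun z => by ring)
  · exact ((hint t s ht.1.le hs.le).sub (hint s s hs.le hs.le)).div_const _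
  · refine (((hint t t ht.1.le ht.1.le).sub (hint t s ht.1.le hs.le)).div_const (t - s)).congr
      (ae_of_all _ fun z => ?_)
    simp only [Pi.sub_apply]
    ring

lemma IsContinuousL1Curve.exists_integral_abs_le (hf : IsContinuousL1Curve f) (T : ℝ) :
    ∃ A, ∀ t ∈ Set.Icc 0 T, ∫ z, |f t z| ≤ A := by
  have habs : IsContinuousL1Curve fun t z => |f t z| :=
    { integrable := fun t ht => (hf.integrable t ht).abs
      continuous := fun s hs => tendsto_of_tendsto_of_tendsto_of_le_of_le tendsto_const_nhds
        (hf.continuous s hs) (fun _ => zero_le) fun t =>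
          eLpNorm_mono fun z => abs_abs_sub_abs_le _ _ }
  have hc : ContinuousOn (fun t => ∫ z, |f t z|) (Set.Icc 0 T) := fun s hs => by
    have := habs.continuousWithinAt_integral_mul (K := 1) hs.1 (q := fun _ _ => 1)
      (fun _ => aestronglyMeasurable_const) (by simp) fun _ => continuousAt_const
    simp only [mul_one] at this
    exact this.mono fun x hx => hx.1
  obtain ⟨A, hA⟩ := isCompact_Icc.exists_bound_of_continuousOn hc
  exact ⟨A, fun t ht => (le_abs_self _).trans (hA t ht)⟩

end L1Curves

/-! ### Weak formulation with time-dependent test functions -/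

section TimeDependent

variable {E : Type*} [NormedAddCommGroup E]

/-- A jointly continuous function that vanishes for `z` off a compact set is bounded on
compact time intervals. -/
lemma exists_bound_of_continuous_uncurry {q : ℝ → E → ℝ} (hq : Continuous q.uncurry) {S : Set E}
    (hS : IsCompact S) (h0 : ∀ t, ∀ z ∉ S, q t z = 0) (a b : ℝ) :
    ∃ K, ∀ t ∈ Set.Icc a b, ∀ z, |q t z| ≤ K := by
  obtain ⟨K, hK⟩ := ((isCompact_Icc (a := a) (b := b)).prod hS).exists_bound_of_continuousOn
    hq.continuousOn
  refine ⟨max K 0, fun t ht z => ?_⟩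
  by_cases hz : z ∈ S
  · exact (hK (t, z) ⟨ht, hz⟩).trans (le_max_left _ _)
  · simp [h0 t z hz]

lemma IsContinuousL1Curve.continuousOn_integral_mul [MeasureSpace E] [BorelSpace E]
    [SecondCountableTopology E] {f : ℝ → E → ℝ} (hf : IsContinuousL1Curve f) {S : Set E}
    (hS : IsCompact S) {q : ℝ → E → ℝ} (hq : Continuous q.uncurry) (h0 : ∀ t, ∀ z ∉ S, q t z = 0) :
    ContinuousOn (fun t => ∫ z, f t z * q t z) (Set.Ici 0) := fun s hs => by
  obtain ⟨K, hK⟩ := exists_bound_of_continuous_uncurry hq hS h0 (s - 1) (s + 1)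
  refine hf.continuousWithinAt_integral_mul (K := K) hs
    (fun t => (hq.comp (Continuous.prodMk_right t)).aestronglyMeasurable) ?_
    fun z => (hq.comp (Continuous.prodMk_left z)).continuousAt
  filter_upwards [Icc_mem_nhds (a := s - 1) (b := s + 1) (x := s) (by linarith) (by linarith)]
    with t ht using hK t ht

/-- A weak formulation with time independent test functions extends to time dependent ones. -/
lemma IsContinuousL1Curve.integral_mul_eq_of_weak [MeasureSpace E] [BorelSpace E]
    [SecondCountableTopology E]
    {f : ℝ → E → ℝ} {f₀ : E → ℝ}
    (hf : IsContinuousL1Curve f) {q q' Lq : ℝ → E → ℝ} {S : Set E} (hS : IsCompact S)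
    (hqc : Continuous q.uncurry) (hq'c : Continuous q'.uncurry) (hLc : Continuous Lq.uncurry)
    (hq0 : ∀ t, ∀ z ∉ S, q t z = 0) (hq'0 : ∀ t, ∀ z ∉ S, q' t z = 0)
    (hL0 : ∀ t, ∀ z ∉ S, Lq t z = 0)
    (hd : ∀ t z, HasDerivAt (fun t => q t z) (q' t z) t)
    (hw : ∀ r t, 0 ≤ t → ∫ z, f t z * q r z =
      (∫ z, f₀ z * q r z) + ∫ s in (0 : ℝ)..t, ∫ z, f s z * Lq r z)
    {T : ℝ} (hT : 0 ≤ T) :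
    ∫ z, f T z * q T z = (∫ z, f₀ z * q 0 z) + ∫ s in (0 : ℝ)..T, ∫ z, f s z * (Lq s z + q' s z) := by
  have hmeas : ∀ {g : ℝ → E → ℝ}, Continuous g.uncurry → ∀ t, AEStronglyMeasurable (g t) :=
    fun hg t => (hg.comp (Continuous.prodMk_right t)).aestronglyMeasurable
  have hcont := fun g => hf.continuousOn_integral_mul (q := g) hS
  have hsum : Continuous (fun t z => Lq t z + q' t z).uncurry := hLc.add hq'c
  -- With the test function frozen at time `s`, the weak formulation and the fundamental theorem of
  -- calculus give the derivative of the pairing; the product rule then adds the `q'` term.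
  have hder : ∀ s ∈ Set.Ioo 0 T, HasDerivAt (fun t => ∫ z, f t z * q t z)
      (∫ z, f s z * (Lq s z + q' s z)) s := fun s hs => by
    obtain ⟨K, hK⟩ := exists_bound_of_continuous_uncurry hq'c hS hq'0 0 (s + 1)
    have hN : ContinuousOn (fun t => ∫ z, f t z * Lq s z) (Set.Ici 0) :=
      hcont (fun _ => Lq s) ((hLc.comp (Continuous.prodMk_right s)).comp continuous_snd)
        fun _ => hL0 s
    have hm : HasDerivAt (fun t => ∫ z, f t z * q s z) (∫ z, f s z * Lq s z) s := by
      have h1 : HasDerivAt (fun t => ∫ r in (0 : ℝ)..t, ∫ z, f r z * Lq s z)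
          (∫ z, f s z * Lq s z) s := by
        refine intervalIntegral.integral_hasDerivAt_right ?_ ?_ (hN.continuousAt (Ici_mem_nhds hs.1))
        · refine (hN.mono ?_).intervalIntegrable
          rw [Set.uIcc_of_le hs.1.le]
          exact fun x hx => hx.1
        · exact (hN.mono Set.Ioi_subset_Ici_self).stronglyMeasurableAtFilter isOpen_Ioi s hs.1
      refine (h1.const_add (∫ z, f₀ z * q s z)).congr_of_eventuallyEq ?_
      filter_upwards [Ioi_mem_nhds hs.1] with t ht using hw s t (le_of_lt ht)
    have := hf.hasDerivAt_integral_mul hs.1 (hmeas hqc) (fun t _ => by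
      obtain ⟨b, hb⟩ := exists_bound_of_continuous_uncurry hqc hS hq0 t t
      exact ⟨b, hb t (by simp)⟩) hd hK hm
    convert this using 1
    rw [← integral_add]
    · exact integral_congr_ae (ae_of_all _ fun z => by ring)
    · obtain ⟨b, hb⟩ := exists_bound_of_continuous_uncurry hLc hS hL0 s s
      exact (hf.integrable s hs.1.le).mul_bdd (c := b) (hmeas hLc s) (ae_of_all _ (hb s (by simp)))
    · exact (hf.integrable s hs.1.le).mul_bdd (c := K) (hmeas hq'c s)
        (ae_of_all _ (hK s ⟨hs.1.le, by linarith⟩))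
  have hsub : Set.Icc 0 T ⊆ Set.Ici 0 := fun x hx => hx.1
  have key := intervalIntegral.integral_eq_sub_of_hasDerivAt_of_le hT
    ((hcont q hqc hq0).mono hsub) hder
    (by
      refine ContinuousOn.intervalIntegrable ?_
      rw [Set.uIcc_of_le hT]
      exact (hcont _ hsum fun t z hz => by simp [hL0 t z hz, hq'0 t z hz]).mono hsub)
  -- At time zero the weak formulation itself encodes the initial condition, tested against `q 0`.
  have h0 := hw 0 0 le_rfl
  rw [intervalIntegral.integral_same, add_zero] at h0
  rw [key, h0]
  ring

end TimeDependent

/-! ### Propagation of the Fourier transform along characteristics -/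

section Characters

variable {E : Type*} [NormedAddCommGroup E] [NormedSpace ℝ E] {ι : Type*} [Fintype ι]

/-- The second order operator `φ ↦ ∑ᵢ ∂ₑᵢ∂ₑᵢ φ + Dφ(z)(B z)` with linear drift `B`. -/
noncomputable def driftDiffusion (e : ι → E) (B : E →L[ℝ] E) (φ : E → ℝ) (z : E) : ℝ :=
  ∑ i, fderiv ℝ (fun y => fderiv ℝ φ y (e i)) z (e i) + fderiv ℝ φ z (B z)

lemma fderiv_cutoff_mul_cos {χ : E → ℝ} (hχ : Differentiable ℝ χ) (ε a θ : ℝ) (l : E →L[ℝ] ℝ)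
    (z v : E) :
    fderiv ℝ (fun z => χ (ε • z) * (a * Real.cos (l z + θ))) z v =
      a * (ε * fderiv ℝ χ (ε • z) v * Real.cos (l z + θ) -
        χ (ε • z) * Real.sin (l z + θ) * l v) := by
  have h1 : HasFDerivAt (fun z => χ (ε • z)) ((fderiv ℝ χ (ε • z)).comp
      (ε • ContinuousLinearMap.id ℝ E)) z :=
    (hχ (ε • z)).hasFDerivAt.comp z ((hasFDerivAt_id z).const_smul ε)
  have h2 : HasFDerivAt (fun z => a * Real.cos (l z + θ)) _ z :=
    ((l.hasFDerivAt (x := z)).add_const θ).cos.const_mul a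
  rw [(h1.fun_mul h2).fderiv]
  simp
  ring

lemma fderiv_cutoff_mul_sin {χ : E → ℝ} (hχ : Differentiable ℝ χ) (ε a θ : ℝ) (l : E →L[ℝ] ℝ)
    (z v : E) :
    fderiv ℝ (fun z => χ (ε • z) * (a * Real.sin (l z + θ))) z v =
      a * (ε * fderiv ℝ χ (ε • z) v * Real.sin (l z + θ) +
        χ (ε • z) * Real.cos (l z + θ) * l v) := by
  have h := fderiv_cutoff_mul_cos hχ ε a (θ - Real.pi / 2) l z v
  simp only [← add_sub_assoc, Real.cos_sub_pi_div_two, Real.sin_sub_pi_div_two] at h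
  rw [h]
  ring

/-- Sorted by where the derivatives fall: terms carrying undifferentiated `χ` are the action on the
character, the others are cutoff errors. Linearity moves `ε` inside the drift, giving `B (ε • z)`,
which stays bounded on the support of the cutoff although `B z` does not. -/
lemma driftDiffusion_cutoff_mul_cos {χ : E → ℝ} (hχ : ContDiff ℝ ∞ χ) (e : ι → E)
    (B : E →L[ℝ] E) (ε a θ : ℝ) (l : E →L[ℝ] ℝ) (z : E) :
    driftDiffusion e B (fun z => χ (ε • z) * (a * Real.cos (l z + θ))) z =
      a * ((ε ^ 2 * ∑ i, fderiv ℝ (fun y => fderiv ℝ χ y (e i)) (ε • z) (e i)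
            + fderiv ℝ χ (ε • z) (B (ε • z)) - χ (ε • z) * ∑ i, l (e i) ^ 2) * Real.cos (l z + θ)
          - (2 * ε * ∑ i, fderiv ℝ χ (ε • z) (e i) * l (e i) + χ (ε • z) * l (B z))
            * Real.sin (l z + θ)) := by
  have hd : Differentiable ℝ χ := hχ.differentiable (by simp)
  have hd1 : ∀ v, Differentiable ℝ fun y => fderiv ℝ χ y v := fun v =>
    ((hχ.fderiv_right (m := ∞) (by simp)).differentiable (by simp)).clm_apply
      (differentiable_const v)
  have h2 : ∀ i, fderiv ℝ (fun y => fderiv ℝ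
      (fun z => χ (ε • z) * (a * Real.cos (l z + θ))) y (e i)) z (e i) =
      a * ((ε ^ 2 * fderiv ℝ (fun y => fderiv ℝ χ y (e i)) (ε • z) (e i)
        - χ (ε • z) * l (e i) ^ 2) * Real.cos (l z + θ)
        - 2 * ε * (fderiv ℝ χ (ε • z) (e i) * l (e i)) * Real.sin (l z + θ)) := fun i => by
    have h3 : (fun y => fderiv ℝ (fun z => χ (ε • z) * (a * Real.cos (l z + θ))) y (e i)) =
        fun y => fderiv ℝ χ (ε • y) (e i) * (a * ε * Real.cos (l y + θ)) -
          χ (ε • y) * (a * l (e i) * Real.sin (l y + θ)) := by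
      funext y
      rw [fderiv_cutoff_mul_cos hd]
      ring
    have hs : ∀ {g : E → ℝ}, Differentiable ℝ g → DifferentiableAt ℝ (fun y => g (ε • y)) z :=
      fun hg => (hg.comp (differentiable_id.const_smul ε)) z
    have hl : DifferentiableAt ℝ (fun y => l y + θ) z :=
      l.differentiableAt.add_const θ
    rw [h3, fderiv_fun_sub ((hs (hd1 (e i))).fun_mul (hl.cos.const_mul _))
      ((hs hd).fun_mul (hl.sin.const_mul _)), sub_apply,
      fderiv_cutoff_mul_cos (hd1 (e i)), fderiv_cutoff_mul_sin hd]
    ring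
  rw [driftDiffusion, Finset.sum_congr rfl fun i _ => h2 i, fderiv_cutoff_mul_cos hd,
    ← Finset.mul_sum, Finset.sum_sub_distrib, ← Finset.sum_mul, ← Finset.sum_mul,
    Finset.sum_sub_distrib, ← Finset.mul_sum, ← Finset.mul_sum, ← Finset.mul_sum]
  simp only [map_smul, smul_eq_mul]
  ring

/-- The Fourier transform of a weak solution of the Fokker–Planck equation with linear drift is
given by the method of characteristics. -/
theorem IsContinuousL1Curve.integral_mul_cos_eq [FiniteDimensional ℝ E] [MeasureSpace E]
    [BorelSpace E] {f : ℝ → E → ℝ} {f₀ : E → ℝ} (hf : IsContinuousL1Curve f)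
    (hf₀ : Integrable f₀) {e : ι → E} {B : E →L[ℝ] E}
    (hw : ∀ φ : E → ℝ, ContDiff ℝ ∞ φ → HasCompactSupport φ → ∀ t, 0 ≤ t →
      ∫ z, f t z * φ z = (∫ z, f₀ z * φ z) +
        ∫ s in (0 : ℝ)..t, ∫ z, f s z * driftDiffusion e B φ z)
    {a : ℝ → ℝ} {l : ℝ → E →L[ℝ] ℝ} (hac : Continuous a) (hlc : Continuous l)
    (hl : ∀ t z, HasDerivAt (fun t => l t z) (-l t (B z)) t)
    (ha : ∀ t, HasDerivAt a (a t * ∑ i, l t (e i) ^ 2) t) (θ : ℝ) {T : ℝ} (hT : 0 ≤ T) :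
    ∫ z, f T z * (a T * Real.cos (l T z + θ)) = ∫ z, f₀ z * (a 0 * Real.cos (l 0 z + θ)) := by
  have : SecondCountableTopology E :=
    have := FiniteDimensional.proper_real E
    secondCountable_of_proper
  let χ : ContDiffBump (0 : E) := ⟨1, 2, one_pos, one_lt_two⟩
  have hχ : ContDiff ℝ ∞ χ := χ.contDiff
  have hχs : HasCompactSupport χ := χ.hasCompactSupport
  have hχ1 : Continuous (fderiv ℝ χ) := (hχ.fderiv_right (m := ∞) (by simp)).continuous
  have hχ2 : ∀ v, Continuous (fderiv ℝ fun y => fderiv ℝ χ y v) := fun v =>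
    (((hχ.fderiv_right (m := ∞) (by simp)).clm_apply contDiff_const).fderiv_right
      (m := ∞) (by simp)).continuous
  have hs0 : ∀ y ∉ tsupport χ, χ y = 0 := fun y hy => image_eq_zero_of_notMem_tsupport hy
  have hs1 : ∀ y ∉ tsupport χ, fderiv ℝ χ y = 0 := fun y hy => fderiv_of_notMem_tsupport ℝ hy
  have hs2 : ∀ v, ∀ y ∉ tsupport χ, fderiv ℝ (fun y => fderiv ℝ χ y v) y = 0 := fun v y hy =>
    fderiv_of_notMem_tsupport ℝ fun h => hy (tsupport_fderiv_apply_subset ℝ v h)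
  -- The cutoff error: what survives when the time derivative of the character cancels the terms
  -- with undifferentiated `χ`. It vanishes at `ε = 0` because `B 0 = 0`.
  let r : ℝ → ℝ → E → ℝ := fun ε t z =>
    a t * ((ε ^ 2 * ∑ i, fderiv ℝ (fun y => fderiv ℝ χ y (e i)) (ε • z) (e i)
      + fderiv ℝ χ (ε • z) (B (ε • z))) * Real.cos (l t z + θ)
      - 2 * ε * (∑ i, fderiv ℝ χ (ε • z) (e i) * l t (e i)) * Real.sin (l t z + θ))
  -- A majorant of `r` in the rescaled variable `y = ε • z`. It is compactly supported in `y`, so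
  -- its bound `K` is uniform in `ε` and no moment of `f` is needed to remove the cutoff.
  let ρ : ℝ → E → ℝ := fun t y =>
    |a t| * (|∑ i, fderiv ℝ (fun y => fderiv ℝ χ y (e i)) y (e i)| + |fderiv ℝ χ y (B y)|
      + 2 * |∑ i, fderiv ℝ χ y (e i) * l t (e i)|)
  have hrc : ∀ ε, Continuous (r ε).uncurry := fun ε => by
    simp only [r, Function.uncurry_def]
    fun_prop
  have hρc : Continuous ρ.uncurry := by
    simp only [ρ, Function.uncurry_def]
    fun_prop
  obtain ⟨K, hK⟩ := exists_bound_of_continuous_uncurry hρc hχs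
    (fun t y hy => by simp [ρ, hs1 y hy, hs2 _ y hy]) 0 T
  have hrρ : ∀ ε ∈ Set.Icc (0 : ℝ) 1, ∀ t z, |r ε t z| ≤ ρ t (ε • z) := fun ε hε t z => by
    have hcos := Real.abs_cos_le_one (l t z + θ)
    have hsin := Real.abs_sin_le_one (l t z + θ)
    simp only [r, ρ, abs_mul]
    refine mul_le_mul_of_nonneg_left ((abs_sub _ _).trans ?_) (abs_nonneg _)
    simp only [abs_mul]
    have hε2 : |ε ^ 2| ≤ 1 := by
      rw [abs_of_nonneg (by positivity)]
      exact pow_le_one₀ hε.1 hε.2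
    have hε1 : |ε| ≤ 1 := abs_le.2 ⟨by linarith [hε.1], hε.2⟩
    refine add_le_add ((mul_le_of_le_one_right (abs_nonneg _) hcos).trans
      ((abs_add_le _ _).trans (add_le_add_left ?_ _)))
      ((mul_le_of_le_one_right (by positivity) hsin).trans ?_)
    · rw [abs_mul]
      exact mul_le_of_le_one_left (abs_nonneg _) hε2
    · rw [abs_two]
      exact mul_le_mul_of_nonneg_right (mul_le_of_le_one_right zero_le_two hε1) (abs_nonneg _)
  have hcut : ∀ ε : ℝ, 0 < ε → ∃ S : Set E, IsCompact S ∧ ∀ z ∉ S, ε • z ∉ tsupport χ := fun ε hε =>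
    ⟨(ε • ·) ⁻¹' tsupport χ, (Homeomorph.smulOfNeZero ε hε.ne').isCompact_preimage.2 hχs,
      fun z hz => hz⟩
  have main : ∀ ε : ℝ, 0 < ε → ∫ z, f T z * (χ (ε • z) * (a T * Real.cos (l T z + θ))) =
      (∫ z, f₀ z * (χ (ε • z) * (a 0 * Real.cos (l 0 z + θ)))) +
        ∫ s in (0 : ℝ)..T, ∫ z, f s z * r ε s z := fun ε hε => by
    obtain ⟨S, hS, hSχ⟩ := hcut ε hε
    have hlz : Continuous fun x : ℝ × E => l x.1 x.2 := by fun_prop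
    have hχc := hχ.continuous
    have hsum : ∀ t z, r ε t z = driftDiffusion e B (fun z => χ (ε • z) *
        (a t * Real.cos (l t z + θ))) z + χ (ε • z) * (a t * (∑ i, l t (e i) ^ 2) *
          Real.cos (l t z + θ) + a t * (Real.sin (l t z + θ) * l t (B z))) := fun t z => by
      rw [driftDiffusion_cutoff_mul_cos hχ]
      simp only [r]
      ring
    simp only [hsum]
    refine hf.integral_mul_eq_of_weak hS
      (q := fun t z => χ (ε • z) * (a t * Real.cos (l t z + θ)))
      (Lq := fun t z => driftDiffusion e B (fun z => χ (ε • z) *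
        (a t * Real.cos (l t z + θ))) z)
      (q' := fun t z => χ (ε • z) * (a t * (∑ i, l t (e i) ^ 2) * Real.cos (l t z + θ) +
        a t * (Real.sin (l t z + θ) * l t (B z)))) ?_ ?_ ?_ ?_ ?_ ?_ ?_ ?_ hT
    · simp only [Function.uncurry_def]
      fun_prop
    · simp only [Function.uncurry_def]
      fun_prop
    · simp only [Function.uncurry_def, driftDiffusion_cutoff_mul_cos hχ]
      fun_prop
    · exact fun t z hz => by simp [hs0 _ (hSχ z hz)]
    · exact fun t z hz => by simp [hs0 _ (hSχ z hz)]
    · exact fun t z hz => by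
        simp [driftDiffusion_cutoff_mul_cos hχ, hs0 _ (hSχ z hz), hs1 _ (hSχ z hz),
          hs2 _ _ (hSχ z hz)]
    · intro t z
      refine (((ha t).mul ((hl t z).add_const θ).cos).const_mul (χ (ε • z))).congr_deriv ?_
      ring
    · intro t s hs
      refine hw _ ?_ (HasCompactSupport.intro hS fun z hz => by simp [hs0 _ (hSχ z hz)]) s hs
      exact (hχ.comp (contDiff_const_smul ε)).mul
        (contDiff_const.mul (((l t).contDiff.add contDiff_const).cos))
  have hε0 : Tendsto (fun n : ℕ => (1 : ℝ) / (n + 1)) atTop (𝓝 0) :=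
    tendsto_one_div_add_atTop_nhds_zero_nat
  have hεpos : ∀ n : ℕ, (0 : ℝ) < 1 / (n + 1) := fun n => Nat.one_div_pos_of_nat
  have hε1 : ∀ n : ℕ, (1 : ℝ) / (n + 1) ≤ 1 := fun n => by
    rw [div_le_one (by positivity)]
    linarith [(n.cast_nonneg : (0 : ℝ) ≤ n)]
  have hlimz : ∀ z : E, Tendsto (fun n : ℕ => ((1 : ℝ) / (n + 1)) • z) atTop (𝓝 0) := fun z => by
    simpa using hε0.smul_const z
  have hpair : ∀ g : E → ℝ, Integrable g → ∀ t, Tendsto (fun n : ℕ => ∫ z, g z *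
      (χ (((1 : ℝ) / (n + 1)) • z) * (a t * Real.cos (l t z + θ)))) atTop
      (𝓝 (∫ z, g z * (a t * Real.cos (l t z + θ)))) := fun g hg t => by
    have hχc := hχ.continuous
    refine tendsto_integral_mul_of_tendsto_eLpNorm (K := |a t|) (Eventually.of_forall fun _ => hg)
      hg (by simp) (Eventually.of_forall fun n => ?_) (Eventually.of_forall fun n z => ?_)
      fun z => ?_
    · exact Continuous.aestronglyMeasurable (by fun_prop)
    · rw [abs_mul, abs_mul, abs_of_nonneg χ.nonneg]
      exact (mul_le_of_le_one_left (by positivity) χ.le_one).trans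
        (mul_le_of_le_one_right (abs_nonneg _) (Real.abs_cos_le_one _))
    · have h1 : Tendsto (fun n : ℕ => χ (((1 : ℝ) / (n + 1)) • z)) atTop (𝓝 1) := by
        have := (hχc.tendsto 0).comp (hlimz z)
        rwa [χ.one_of_mem_closedBall (by simp [χ])] at this
      simpa using h1.mul_const (a t * Real.cos (l t z + θ))
  -- Dominated convergence twice: in `z` with majorant $K|f_s|$, then in `s` with the constant `A *
  -- K`, where `A` bounds the $L^1$ norms on $[0,T]$.
  have hrem : Tendsto (fun n : ℕ => ∫ s in (0 : ℝ)..T, ∫ z, f s z * r (1 / (n + 1)) s z) atTop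
      (𝓝 (∫ s in (0 : ℝ)..T, (0 : ℝ))) := by
    obtain ⟨A, hA⟩ := hf.exists_integral_abs_le T
    have hsub : Set.uIoc 0 T ⊆ Set.Icc 0 T := by
      rw [Set.uIoc_of_le hT]
      exact Set.Ioc_subset_Icc_self
    refine intervalIntegral.tendsto_integral_filter_of_dominated_convergence (fun _ => A * K)
      (Eventually.of_forall fun n => ?_) (Eventually.of_forall fun n => ?_) (by simp)
      (ae_of_all _ fun s hs => ?_)
    · obtain ⟨S, hS, hSχ⟩ := hcut _ (hεpos n)
      exact ((hf.continuousOn_integral_mul hS (hrc _) fun t z hz => by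
        simp only [r, hs1 _ (hSχ z hz), hs2 _ _ (hSχ z hz)]
        simp).mono
          (hsub.trans fun x hx => hx.1)).aestronglyMeasurable measurableSet_uIoc
    · refine ae_of_all _ fun s hs => ?_
      have hs' := hsub hs
      have hK0 : 0 ≤ K := (abs_nonneg _).trans (hK s hs' 0)
      refine (norm_integral_le_of_norm_le ((hf.integrable s hs'.1).abs.mul_const K)
        (ae_of_all _ fun z => ?_)).trans ?_
      · rw [norm_mul]
        exact mul_le_mul_of_nonneg_left ((hrρ _ ⟨(hεpos n).le, hε1 n⟩ s z).trans
          ((le_abs_self _).trans (hK s hs' _))) (abs_nonneg _)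
      · rw [integral_mul_const]
        exact mul_le_mul_of_nonneg_right (hA s hs') hK0
    · have hs' := hsub hs
      have := tendsto_integral_mul_of_tendsto_eLpNorm (μ := volume) (l := atTop)
        (f := fun _ : ℕ => f s) (f₁ := f s) (q := fun n : ℕ => r (1 / (n + 1)) s)
        (q₁ := fun _ => 0) (K := K)
        (Eventually.of_forall fun _ => hf.integrable s hs'.1) (hf.integrable s hs'.1) (by simp)
        (Eventually.of_forall fun n =>
          ((hrc _).comp (Continuous.prodMk_right s)).aestronglyMeasurable)
        (Eventually.of_forall fun n z => (hrρ _ ⟨(hεpos n).le, hε1 n⟩ s z).trans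
          ((le_abs_self _).trans (hK s hs' _))) fun z => by
          have hc : Continuous fun ε => r ε s z := by
            simp only [r]
            fun_prop
          have h0 : r 0 s z = 0 := by simp [r]
          rw [← h0]
          exact (hc.tendsto 0).comp hε0
      simpa using this
  rw [intervalIntegral.integral_zero] at hrem
  have hlim := (hpair f₀ hf₀ 0).add hrem
  rw [add_zero] at hlim
  exact tendsto_nhds_unique ((hpair (f T) (hf.integrable T hT) T).congr fun n => main _ (hεpos n))
    hlim

end Characters

/-! ### Injectivity of the Fourier transform on $L^1$ -/

section FourierUniqueness

variable {E : Type*} [NormedAddCommGroup E] [NormedSpace ℝ E] [CompleteSpace E]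
  [SecondCountableTopology E] [MeasurableSpace E] [BorelSpace E]

/-- An integrable real function is determined by its Fourier transform. -/
theorem ae_eq_zero_of_forall_integral_mul_cos_eq_zero {μ : Measure E} [SigmaFinite μ] {h : E → ℝ}
    (hh : Integrable h μ) (h0 : ∀ (l : E →L[ℝ] ℝ) (θ : ℝ), ∫ z, h z * Real.cos (l z + θ) ∂μ = 0) :
    h =ᵐ[μ] 0 := by
  have hfin := isFiniteMeasure_withDensity_ofReal hh.2
  have hfin' := isFiniteMeasure_withDensity_ofReal hh.neg.2
  have hm : AEMeasurable h μ := hh.aestronglyMeasurable.aemeasurable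
  have hbdd : ∀ {g : E → ℝ} (l : E →L[ℝ] ℝ), Integrable g μ →
      Integrable (fun z => (g z : ℂ) * Complex.exp (l z * Complex.I)) μ := fun l hg =>
    hg.ofReal.mul_bdd (c := 1) (Continuous.aestronglyMeasurable (by fun_prop))
      (ae_of_all _ fun z => (Complex.norm_exp_ofReal_mul_I _).le)
  have hchar : ∀ {g : E → ℝ} (l : E →L[ℝ] ℝ), AEMeasurable g μ →
      charFunDual (μ.withDensity fun z => ENNReal.ofReal (g z)) l =
        ∫ z, ((max (g z) 0 : ℝ) : ℂ) * Complex.exp (l z * Complex.I) ∂μ := fun l hg => by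
    rw [charFunDual_apply, integral_withDensity_eq_integral_toReal_smul₀ hg.ennreal_ofReal
      (ae_of_all _ fun _ => ENNReal.ofReal_lt_top)]
    refine integral_congr_ae (ae_of_all _ fun z => ?_)
    simp only [ENNReal.toReal_ofReal', Complex.real_smul]
  -- The positive and negative parts of `h` are densities of finite measures, so uniqueness for
  -- characteristic functions of measures applies.
  have heq : (μ.withDensity fun z => ENNReal.ofReal (h z)) =
      μ.withDensity fun z => ENNReal.ofReal (-h z) := by
    refine Measure.ext_of_charFunDual (funext fun l => ?_)
    rw [hchar l hm, hchar (g := fun z => -h z) l hm.neg, ← sub_eq_zero,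
      ← integral_sub (hbdd l hh.pos_part) (hbdd l hh.neg_part)]
    -- The phases $0$ and $-\pi/2$ recover the real and imaginary parts of the complex character.
    have hpm : ∀ z, ((max (h z) 0 : ℝ) : ℂ) * Complex.exp (l z * Complex.I) -
        ((max (-h z) 0 : ℝ) : ℂ) * Complex.exp (l z * Complex.I) =
        ((h z * Real.cos (l z + 0) : ℝ) : ℂ) +
          ((h z * Real.cos (l z + -(Real.pi / 2)) : ℝ) : ℂ) * Complex.I := fun z => by
      have h1 : h z = max (h z) 0 - max (-h z) 0 := by
        rcases le_total (h z) 0 with hz | hz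
        · rw [max_eq_right hz, max_eq_left (by linarith)]; ring
        · rw [max_eq_left hz, max_eq_right (by linarith)]; ring
      rw [← sub_mul, ← Complex.ofReal_sub, ← h1, Complex.exp_mul_I, ← sub_eq_add_neg,
        Real.cos_sub_pi_div_two, add_zero]
      push_cast
      ring
    have hcos : ∀ θ, Integrable (fun z => h z * Real.cos (l z + θ)) μ := fun θ =>
      hh.mul_bdd (c := 1) (Continuous.aestronglyMeasurable (by fun_prop))
        (ae_of_all _ fun z => Real.abs_cos_le_one _)
    simp only [hpm]
    rw [integral_add (hcos 0).ofReal ((hcos _).ofReal.mul_const _), integral_mul_const,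
      integral_complex_ofReal, integral_complex_ofReal, h0, h0]
    simp
  have hae := (withDensity_eq_iff hm.ennreal_ofReal hm.neg.ennreal_ofReal
    (by simpa using (hh.lintegral_lt_top).ne)).1 heq
  filter_upwards [hae] with z hz
  have hz' := congrArg ENNReal.toReal hz
  simp only [ENNReal.toReal_ofReal', Pi.neg_apply] at hz'
  rcases le_total (h z) 0 with h1 | h1
  · rw [max_eq_right h1, max_eq_left (by linarith)] at hz'
    simp only [Pi.zero_apply]; linarith
  · rw [max_eq_left h1, max_eq_right (by linarith)] at hz'
    exact hz'

end FourierUniqueness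

/-! ### Fourier transforms of the two weak solutions -/

section Equations

variable {d : ℕ}

local notation "V" => EuclideanSpace ℝ (Fin d)

lemma laplacian_eq_sum_fderiv {φ : V → ℝ} (hφ : ContDiff ℝ ∞ φ) (x : V) :
    Laplacian.laplacian φ x = ∑ i, fderiv ℝ (fun y => fderiv ℝ φ y
      (EuclideanSpace.basisFun (Fin d) ℝ i)) x (EuclideanSpace.basisFun (Fin d) ℝ i) := by
  rw [InnerProductSpace.laplacian_eq_iteratedFDeriv_orthonormalBasis φ
    (EuclideanSpace.basisFun (Fin d) ℝ)]
  refine Finset.sum_congr rfl fun i _ => ?_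
  have h1 : DifferentiableAt ℝ (fderiv ℝ φ) x :=
    ((hφ.fderiv_right (m := ∞) (by simp)).differentiable (by simp)) x
  rw [iteratedFDeriv_two_apply, fderiv_clm_apply h1 (differentiableAt_const _)]
  simp

lemma sum_inner_basisFun_sq (ξ : V) :
    ∑ i, inner ℝ ξ (EuclideanSpace.basisFun (Fin d) ℝ i) ^ 2 = ‖ξ‖ ^ 2 := by
  rw [← OrthonormalBasis.sum_sq_norm_inner_left (EuclideanSpace.basisFun (Fin d) ℝ) ξ]
  simp

/-- The Fourier transform of a weak solution of the heat equation. -/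
theorem IsHeatSolution.integral_mul_cos {u₀ : V → ℝ} {u : ℝ → V → ℝ} (hu : IsHeatSolution u₀ u)
    (hu₀ : Integrable u₀) (ξ : V) (θ : ℝ) {t : ℝ} (ht : 0 ≤ t) :
    ∫ x, u t x * Real.cos (inner ℝ ξ x + θ) =
      Real.exp (-(t * ‖ξ‖ ^ 2)) * ∫ x, u₀ x * Real.cos (inner ℝ ξ x + θ) := by
  have h := hu.curve.integral_mul_cos_eq hu₀ (e := EuclideanSpace.basisFun (Fin d) ℝ) (B := 0)
    (fun φ hφ hφc t ht => by
      rw [hu.weak φ hφ hφc t ht]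
      simp [driftDiffusion, laplacian_eq_sum_fderiv hφ])
    -- Without drift the characteristics are constant frequencies.
    (a := fun s => Real.exp (s * ‖ξ‖ ^ 2)) (l := fun _ => innerSL ℝ ξ) (by fun_prop) (by fun_prop)
    (fun s z => by simpa using hasDerivAt_const s _)
    (fun s => by
      simp only [innerSL_apply_apply, sum_inner_basisFun_sq]
      simpa using ((hasDerivAt_id s).mul_const (‖ξ‖ ^ 2)).exp) θ ht
  simp only [innerSL_apply_apply, zero_mul, Real.exp_zero, one_mul, mul_left_comm _ (Real.exp _),
    integral_const_mul] at h
  rw [← h, ← mul_assoc, ← Real.exp_add]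
  simp

lemma kfpAdjoint_eq_driftDiffusion {φ : V × V → ℝ} (hφ : ContDiff ℝ ∞ φ) (z : V × V) :
    kfpAdjoint φ z = driftDiffusion (fun i => ((0 : V), EuclideanSpace.basisFun (Fin d) ℝ i))
      ((ContinuousLinearMap.snd ℝ V V).prod (-ContinuousLinearMap.snd ℝ V V)) φ z := by
  have hd : Differentiable ℝ φ := hφ.differentiable (by simp)
  have hpart : ∀ {g : V × V → ℝ} (_ : Differentiable ℝ g) (v w : V),
      fderiv ℝ (fun v => g (z.1, v)) v w = fderiv ℝ g (z.1, v) (0, w) := fun {g} hg v w => by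
    have h1 : HasFDerivAt (fun v : V => (z.1, v)) (ContinuousLinearMap.inr ℝ V V) v :=
      hasFDerivAt_prodMk_right z.1 v
    have h2 : HasFDerivAt (fun v => g (z.1, v)) _ v := (hg (z.1, v)).hasFDerivAt.comp v h1
    rw [h2.fderiv]
    simp
  have hsplit : fderiv ℝ φ z (z.2, -z.2) = fderiv ℝ φ z (z.2, 0) - fderiv ℝ φ z (0, z.2) := by
    rw [← map_sub]
    simp
  rw [kfpAdjoint, driftDiffusion, laplacian_eq_sum_fderiv (by fun_prop)]
  have h2 : ∀ i, fderiv ℝ (fun y => fderiv ℝ (fun v => φ (z.1, v)) y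
      (EuclideanSpace.basisFun (Fin d) ℝ i)) z.2 (EuclideanSpace.basisFun (Fin d) ℝ i) =
      fderiv ℝ (fun y => fderiv ℝ φ y (0, EuclideanSpace.basisFun (Fin d) ℝ i)) z
        (0, EuclideanSpace.basisFun (Fin d) ℝ i) := fun i => by
    simp only [hpart hd]
    exact hpart (g := fun y => fderiv ℝ φ y (0, EuclideanSpace.basisFun (Fin d) ℝ i))
      (((hφ.fderiv_right (m := ∞) (by simp)).differentiable (by simp)).clm_apply
        (differentiable_const _)) z.2 _
  simp only [h2, ContinuousLinearMap.prod_apply, ContinuousLinearMap.coe_snd', neg_apply, hsplit]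
  ring

/-- The Fourier transform of a weak solution of the kinetic Fokker–Planck equation. -/
theorem IsKFPSolution.integral_mul_cos {f₀ : V × V → ℝ} {f : ℝ → V × V → ℝ}
    (hf : IsKFPSolution f₀ f) (hf₀ : Integrable f₀) (ξ η : V) (θ : ℝ) {t : ℝ} (ht : 0 ≤ t) :
    ∫ z, f t z * Real.cos (inner ℝ ξ z.1 + inner ℝ η z.2 + θ) =
      Real.exp (-(t * ‖ξ‖ ^ 2 + 2 * inner ℝ ξ (η - ξ) * (1 - Real.exp (-t)) +
        ‖η - ξ‖ ^ 2 * (1 - Real.exp (-t) ^ 2) / 2)) *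
      ∫ z, f₀ z * Real.cos (inner ℝ ξ z.1 + inner ℝ (ξ + Real.exp (-t) • (η - ξ)) z.2 + θ) := by
  -- For the drift $(x,v)\mapsto(v,-v)$ the equation $\dot l=-l\circ B$ keeps $\xi$ fixed and reads
  -- $\dot\eta'=\eta'-\xi$, solved here with final value $\eta'(t)=\eta$. As diffusion acts only in
  -- velocity, the logarithm `A` of the amplitude is a primitive of $|\eta'|^2$.
  let η' : ℝ → V := fun s => ξ + Real.exp (s - t) • (η - ξ)
  let A : ℝ → ℝ := fun s => s * ‖ξ‖ ^ 2 + 2 * inner ℝ ξ (η - ξ) * Real.exp (s - t) +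
    ‖η - ξ‖ ^ 2 * Real.exp (s - t) ^ 2 / 2
  have hexp : ∀ s, HasDerivAt (fun s => Real.exp (s - t)) (Real.exp (s - t)) s := fun s => by
    simpa using ((hasDerivAt_id s).sub_const t).exp
  have hA : ∀ s, HasDerivAt A (‖η' s‖ ^ 2) s := fun s => by
    have h1 := (((hasDerivAt_id s).mul_const (‖ξ‖ ^ 2)).add
      ((hexp s).const_mul (2 * inner ℝ ξ (η - ξ)))).add
      ((((hexp s).pow 2).const_mul (‖η - ξ‖ ^ 2)).div_const 2)
    refine h1.congr_deriv ?_
    simp only [η']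
    rw [norm_add_sq_real, norm_smul, inner_smul_right, mul_pow, Real.norm_eq_abs, sq_abs]
    push_cast
    ring
  have h := hf.curve.integral_mul_cos_eq hf₀
    (e := fun i => ((0 : V), EuclideanSpace.basisFun (Fin d) ℝ i))
    (B := (ContinuousLinearMap.snd ℝ V V).prod (-ContinuousLinearMap.snd ℝ V V))
    (fun φ hφ hφc t ht => by
      rw [hf.weak φ hφ hφc t ht]
      simp only [kfpAdjoint_eq_driftDiffusion hφ])
    (a := fun s => Real.exp (A s)) (l := fun s => (innerSL ℝ ξ).comp (ContinuousLinearMap.fst ℝ V V)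
      + (innerSL ℝ (η' s)).comp (ContinuousLinearMap.snd ℝ V V)) (by simp only [A]; fun_prop)
    (by
      simp only [η']
      fun_prop)
    (fun s z => by
      simp only [add_apply, ContinuousLinearMap.comp_apply, ContinuousLinearMap.coe_fst',
        ContinuousLinearMap.coe_snd', innerSL_apply_apply, ContinuousLinearMap.prod_apply,
        neg_apply, η', inner_add_left, inner_smul_left, inner_neg_right]
      refine ((((hexp s).mul_const (inner ℝ (η - ξ) z.2)).const_add
        (inner ℝ ξ z.2)).const_add (inner ℝ ξ z.1)).congr_deriv ?_
      simp)
    (fun s => by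
      simp only [add_apply, ContinuousLinearMap.comp_apply, ContinuousLinearMap.coe_fst',
        ContinuousLinearMap.coe_snd', innerSL_apply_apply, inner_zero_right, zero_add,
        sum_inner_basisFun_sq]
      exact (hA s).exp) θ ht
  simp only [add_apply, ContinuousLinearMap.comp_apply, ContinuousLinearMap.coe_fst',
    ContinuousLinearMap.coe_snd', innerSL_apply_apply, mul_left_comm _ (Real.exp _),
    integral_const_mul, η', A, sub_self, Real.exp_zero, one_smul, zero_sub, add_sub_cancel] at h
  rw [← mul_right_inj' (Real.exp_ne_zero (A t)), ← mul_assoc, ← Real.exp_add]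
  simp only [A, sub_self, Real.exp_zero]
  rw [h]
  congr 2
  ring

end Equations

/-! ### Gaussian densities and their perturbation in mean and variance -/

section Gaussian

variable {d : ℕ}

/-- The centred isotropic Gaussian density with variance `a` in each direction. -/
noncomputable def gaussianDensity (a : ℝ) (z : EuclideanSpace ℝ (Fin d)) : ℝ :=
  (2 * Real.pi * a) ^ (-(d : ℝ) / 2) * Real.exp (-‖z‖ ^ 2 / (2 * a))

lemma maxwellian_eq_gaussianDensity :
    maxwellian (d := d) = gaussianDensity 1 := by
  funext v
  simp [maxwellian, gaussianDensity]

@[fun_prop]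
lemma continuous_gaussianDensity (a : ℝ) : Continuous (gaussianDensity (d := d) a) := by
  unfold gaussianDensity
  fun_prop

variable {a b κ : ℝ} (z m ξ : EuclideanSpace ℝ (Fin d))

lemma gaussianDensity_nonneg (ha : 0 < a) : 0 ≤ gaussianDensity a z := by
  unfold gaussianDensity
  positivity

lemma gaussianDensity_le (ha : 0 < a) :
    gaussianDensity a z ≤ (2 * Real.pi * a) ^ (-(d : ℝ) / 2) := by
  refine mul_le_of_le_one_right (by positivity) (Real.exp_le_one_iff.2 ?_)
  exact div_nonpos_of_nonpos_of_nonneg (by simp) (by positivity)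

/-- Passing to twice the variance. -/
lemma gaussianDensity_eq_two_mul (ha : 0 < a) :
    gaussianDensity a z =
      2 ^ ((d : ℝ) / 2) * (Real.exp (-‖z‖ ^ 2 / (4 * a)) * gaussianDensity (2 * a) z) := by
  unfold gaussianDensity
  have h1 : (2 * Real.pi * (2 * a)) ^ (-(d : ℝ) / 2) =
      2 ^ (-(d : ℝ) / 2) * (2 * Real.pi * a) ^ (-(d : ℝ) / 2) := by
    rw [← Real.mul_rpow (by norm_num) (by positivity)]
    ring_nf
  have h2 : (2 : ℝ) ^ ((d : ℝ) / 2) * 2 ^ (-(d : ℝ) / 2) = 1 := by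
    rw [← Real.rpow_add two_pos]
    ring_nf
    exact Real.rpow_zero _
  have h3 : -‖z‖ ^ 2 / (2 * a) = -‖z‖ ^ 2 / (4 * a) + -‖z‖ ^ 2 / (2 * (2 * a)) := by
    field_simp
    ring
  rw [h1, h3, Real.exp_add]
  linear_combination (-(2 * Real.pi * a) ^ (-(d : ℝ) / 2) * Real.exp (-‖z‖ ^ 2 / (4 * a)) *
    Real.exp (-‖z‖ ^ 2 / (2 * (2 * a)))) * h2

lemma integral_cexp_gaussianDensity (ha : 0 < a) :
    Integrable (fun z => (gaussianDensity a z : ℂ) * Complex.exp (Complex.I * inner ℝ ξ z)) ∧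
    ∫ z, (gaussianDensity a z : ℂ) * Complex.exp (Complex.I * inner ℝ ξ z) =
      Complex.exp (-(a * ‖ξ‖ ^ 2 / 2)) := by
  have hb : 0 < (1 / (2 * a) : ℂ).re := by
    have : (1 / (2 * a) : ℂ) = ((1 / (2 * a) : ℝ) : ℂ) := by push_cast; rfl
    rw [this, Complex.ofReal_re]
    positivity
  have heq : ∀ z : EuclideanSpace ℝ (Fin d),
      (gaussianDensity a z : ℂ) * Complex.exp (Complex.I * inner ℝ ξ z) =
      (((2 * Real.pi * a) ^ (-(d : ℝ) / 2) : ℝ) : ℂ) *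
        Complex.exp (-(1 / (2 * a)) * ‖z‖ ^ 2 + Complex.I * inner ℝ ξ z) := fun z => by
    rw [gaussianDensity, Complex.exp_add]
    push_cast
    rw [← mul_assoc]
    congr 3
    ring
  simp only [heq]
  refine ⟨(GaussianFourier.integrable_cexp_neg_mul_sq_norm_add hb Complex.I ξ).const_mul _, ?_⟩
  rw [integral_const_mul, GaussianFourier.integral_cexp_neg_mul_sq_norm_add hb]
  have h1 : (Real.pi / (1 / (2 * a)) : ℂ) = ((2 * Real.pi * a : ℝ) : ℂ) := by
    push_cast
    rw [div_div_eq_mul_div, div_one]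
    ring
  have h2 : (Module.finrank ℝ (EuclideanSpace ℝ (Fin d)) / 2 : ℂ) = (((d : ℝ) / 2 : ℝ) : ℂ) := by
    simp
  have ha' : (a : ℂ) ≠ 0 := by exact_mod_cast ha.ne'
  rw [h1, h2, ← Complex.ofReal_cpow (by positivity), ← mul_assoc, ← Complex.ofReal_mul,
    ← Real.rpow_add (by positivity), neg_div, neg_add_cancel, Real.rpow_zero, Complex.ofReal_one,
    one_mul, Complex.I_sq]
  congr 1
  field_simp
  ring

lemma integrable_gaussianDensity (ha : 0 < a) : Integrable (gaussianDensity (d := d) a) := by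
  simpa using (integral_cexp_gaussianDensity 0 ha).1.re

lemma integral_gaussianDensity_mul_cos (ha : 0 < a) (θ : ℝ) :
    ∫ z, gaussianDensity a (z - m) * Real.cos (inner ℝ ξ z + θ) =
      Real.exp (-(a * ‖ξ‖ ^ 2 / 2)) * Real.cos (inner ℝ ξ m + θ) := by
  rw [← integral_add_right_eq_self _ m]
  obtain ⟨h1, h2⟩ := integral_cexp_gaussianDensity ξ ha
  have h3 := congrArg (fun c : ℂ => (Complex.exp (Complex.I * (inner ℝ ξ m + θ : ℝ)) * c).re) h2
  rw [← integral_const_mul] at h3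
  have h4 := integral_re (h1.const_mul (Complex.exp (Complex.I * (inner ℝ ξ m + θ : ℝ))))
  simp only [RCLike.re_to_complex] at h4
  rw [← h4] at h3
  have h5 : ((-(a * ‖ξ‖ ^ 2 / 2) : ℂ)) = ((-(a * ‖ξ‖ ^ 2 / 2) : ℝ) : ℂ) := by push_cast; rfl
  rw [h5, ← Complex.ofReal_exp, Complex.re_mul_ofReal, mul_comm Complex.I,
    Complex.exp_ofReal_mul_I_re] at h3
  rw [mul_comm (Real.exp _), ← h3]
  refine integral_congr_ae (ae_of_all _ fun z => ?_)
  simp only [add_sub_cancel_right]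
  rw [mul_left_comm, Complex.re_ofReal_mul, ← Complex.exp_add, mul_comm Complex.I, ← add_mul,
    ← Complex.ofReal_add, Complex.exp_ofReal_mul_I_re, inner_add_right]
  congr 2
  ring

lemma integral_gaussianDensity (ha : 0 < a) : ∫ z, gaussianDensity (d := d) a z = 1 := by
  simpa using integral_gaussianDensity_mul_cos (d := d) 0 0 ha 0

lemma lintegral_gaussianDensity_sub (ha : 0 < a) :
    ∫⁻ z, ENNReal.ofReal (gaussianDensity a (z - m)) = 1 := by
  rw [lintegral_sub_right_eq_self (fun z => ENNReal.ofReal (gaussianDensity a z)) m,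
    ← ofReal_integral_eq_lintegral_ofReal (integrable_gaussianDensity ha)
      (ae_of_all _ fun z => gaussianDensity_nonneg z ha), integral_gaussianDensity ha,
    ENNReal.ofReal_one]

lemma lintegral_gaussianDensity (ha : 0 < a) :
    ∫⁻ z, ENNReal.ofReal (gaussianDensity (d := d) a z) = 1 := by
  simpa using lintegral_gaussianDensity_sub (d := d) 0 ha

lemma mul_exp_neg_sq_div_four_le_one (x : ℝ) : x * Real.exp (-x ^ 2 / 4) ≤ 1 := by
  have h1 := Real.add_one_le_exp (x ^ 2 / 4)
  rw [neg_div, Real.exp_neg, ← div_eq_mul_inv, div_le_one (Real.exp_pos _)]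
  nlinarith [sq_nonneg (x / 2 - 1)]

/-- Half of the exponent absorbs the factor `‖z‖` at the price of one standard deviation; the other
half is a Gaussian of doubled variance. The next lemma treats `‖z‖ ^ 2` the same way. -/
lemma norm_mul_gaussianDensity_le (ha : 0 < a) :
    ‖z‖ * gaussianDensity a z ≤ 2 ^ ((d : ℝ) / 2) * √a * gaussianDensity (2 * a) z := by
  have h1 := mul_exp_neg_sq_div_four_le_one (‖z‖ / √a)
  have hs : 0 < √a := Real.sqrt_pos.2 ha
  have h2 : -(‖z‖ / √a) ^ 2 / 4 = -‖z‖ ^ 2 / (4 * a) := by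
    rw [div_pow, Real.sq_sqrt ha.le]
    field_simp
  have hg := gaussianDensity_nonneg z (mul_pos two_pos ha)
  rw [h2, div_mul_eq_mul_div, div_le_one hs] at h1
  rw [gaussianDensity_eq_two_mul z ha]
  calc _ = 2 ^ ((d : ℝ) / 2) * (‖z‖ * Real.exp (-‖z‖ ^ 2 / (4 * a))) *
        gaussianDensity (2 * a) z := by ring
    _ ≤ _ := by gcongr

lemma norm_sq_mul_gaussianDensity_le (ha : 0 < a) :
    ‖z‖ ^ 2 * gaussianDensity a z ≤ 2 ^ ((d : ℝ) / 2) * (4 * a) * gaussianDensity (2 * a) z := by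
  have h1 : ‖z‖ ^ 2 * Real.exp (-‖z‖ ^ 2 / (4 * a)) ≤ 4 * a := by
    have h2 := Real.add_one_le_exp (‖z‖ ^ 2 / (4 * a))
    rw [neg_div, Real.exp_neg, ← div_eq_mul_inv, div_le_iff₀ (Real.exp_pos _)]
    calc ‖z‖ ^ 2 = 4 * a * (‖z‖ ^ 2 / (4 * a)) := by field_simp
      _ ≤ _ := by gcongr; linarith
  have hg := gaussianDensity_nonneg z (mul_pos two_pos ha)
  rw [gaussianDensity_eq_two_mul z ha]
  calc _ = 2 ^ ((d : ℝ) / 2) * (‖z‖ ^ 2 * Real.exp (-‖z‖ ^ 2 / (4 * a))) *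
        gaussianDensity (2 * a) z := by ring
    _ ≤ _ := by gcongr

lemma gaussianDensity_le_two_mul (ha : 0 < a) :
    gaussianDensity a z ≤ 2 ^ ((d : ℝ) / 2) * gaussianDensity (2 * a) z := by
  have hg := gaussianDensity_nonneg z (mul_pos two_pos ha)
  rw [gaussianDensity_eq_two_mul z ha]
  gcongr
  refine mul_le_of_le_one_left hg (Real.exp_le_one_iff.2 ?_)
  exact div_nonpos_of_nonpos_of_nonneg (by simp) (by positivity)

/-- The derivative $-re^{-r^2/2}$ is at most $e^{-r^2/4}$ in size, hence at most its value at the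
smaller endpoint; keeping both endpoints makes the bound symmetric. -/
lemma abs_exp_neg_sq_sub_exp_neg_sq_le {x y : ℝ} (hx : 0 ≤ x) (hy : 0 ≤ y) :
    |Real.exp (-x ^ 2 / 2) - Real.exp (-y ^ 2 / 2)| ≤
      |x - y| * (Real.exp (-x ^ 2 / 4) + Real.exp (-y ^ 2 / 4)) := by
  wlog hxy : x ≤ y generalizing x y
  · rw [abs_sub_comm, abs_sub_comm x y, add_comm]
    exact this hy hx (le_of_not_ge hxy)
  have hd : ∀ r, HasDerivAt (fun r : ℝ => Real.exp (-r ^ 2 / 2)) (Real.exp (-r ^ 2 / 2) * -r) r :=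
    fun r => by
      refine (((hasDerivAt_pow 2 r).neg.div_const 2).exp).congr_deriv ?_
      norm_num
      ring
  have h := (convex_Icc x y).norm_image_sub_le_of_norm_hasDerivWithin_le
    (C := Real.exp (-x ^ 2 / 4)) (fun r _ => (hd r).hasDerivWithinAt) (fun r hr => by
      have hr0 : 0 ≤ r := hx.trans hr.1
      rw [norm_mul, norm_neg, Real.norm_eq_abs, Real.norm_eq_abs, Real.abs_exp, abs_of_nonneg hr0]
      have h1 : -r ^ 2 / 2 = -r ^ 2 / 4 + -r ^ 2 / 4 := by ring
      rw [h1, Real.exp_add, mul_assoc, mul_comm (Real.exp _) r]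
      refine (mul_le_of_le_one_right (Real.exp_pos _).le (mul_exp_neg_sq_div_four_le_one r)).trans ?_
      gcongr
      exact hr.1) (Set.right_mem_Icc.2 hxy) (Set.left_mem_Icc.2 hxy)
  rw [Real.norm_eq_abs, Real.norm_eq_abs] at h
  refine h.trans ?_
  rw [mul_comm]
  gcongr
  linarith [Real.exp_pos (-y ^ 2 / 4)]

/-- The density is radial, so the one-dimensional estimate at `‖z - m‖ / √a` and `‖z‖ / √a`
suffices. Only the two end centres appear, with no integral over intermediate shifts. -/
lemma abs_gaussianDensity_sub_sub_le (ha : 0 < a) :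
    |gaussianDensity a (z - m) - gaussianDensity a z| ≤ 2 ^ ((d : ℝ) / 2) * (‖m‖ / √a) *
      (gaussianDensity (2 * a) (z - m) + gaussianDensity (2 * a) z) := by
  have hs : 0 < √a := Real.sqrt_pos.2 ha
  have h := abs_exp_neg_sq_sub_exp_neg_sq_le (x := ‖z - m‖ / √a) (y := ‖z‖ / √a)
    (by positivity) (by positivity)
  have h2 : ∀ y : EuclideanSpace ℝ (Fin d), ∀ c : ℝ,
      -(‖y‖ / √a) ^ 2 / c = -‖y‖ ^ 2 / (c * a) := fun y c => by
    rw [div_pow, Real.sq_sqrt ha.le, ← neg_div, div_div, mul_comm]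
  simp only [h2] at h
  have h3 : |‖z - m‖ / √a - ‖z‖ / √a| ≤ ‖m‖ / √a := by
    rw [← sub_div, abs_div, abs_of_pos hs]
    gcongr
    simpa using abs_norm_sub_norm_le (z - m) z
  have h4 : ∀ y : EuclideanSpace ℝ (Fin d), 2 ^ ((d : ℝ) / 2) * gaussianDensity (2 * a) y =
      (2 * Real.pi * a) ^ (-(d : ℝ) / 2) * Real.exp (-‖y‖ ^ 2 / (4 * a)) := fun y => by
    have h5 := gaussianDensity_eq_two_mul y ha
    have h6 : -‖y‖ ^ 2 / (2 * a) = -‖y‖ ^ 2 / (4 * a) + -‖y‖ ^ 2 / (4 * a) := by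
      field_simp
      ring
    rw [gaussianDensity, h6, Real.exp_add] at h5
    refine mul_left_cancel₀ (Real.exp_ne_zero (-‖y‖ ^ 2 / (4 * a))) ?_
    linarith
  calc |gaussianDensity a (z - m) - gaussianDensity a z|
      = (2 * Real.pi * a) ^ (-(d : ℝ) / 2) *
        |Real.exp (-‖z - m‖ ^ 2 / (2 * a)) - Real.exp (-‖z‖ ^ 2 / (2 * a))| := by
        rw [gaussianDensity, gaussianDensity, ← mul_sub, abs_mul, abs_of_nonneg (by positivity)]
    _ ≤ (2 * Real.pi * a) ^ (-(d : ℝ) / 2) * (‖m‖ / √a * (Real.exp (-‖z - m‖ ^ 2 / (4 * a)) +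
          Real.exp (-‖z‖ ^ 2 / (4 * a)))) := by
        gcongr
        exact h.trans (by gcongr)
    _ = _ := by
        linear_combination (-(‖m‖ / √a)) * h4 (z - m) - ‖m‖ / √a * h4 z

/-- The ratio of the densities is $(b/a)^{d/2}\exp(-|z|^2(b-a)/(2ab))$. Dropping the exponential
bounds it above by the prefactor; dropping the prefactor bounds it below by $1$ minus the exponent,
whose $|z|^2$ is absorbed by doubling the variance. -/
lemma abs_gaussianDensity_sub_le (hκ : 0 < κ) (hb : 0 < b) (hab : κ * b ≤ a) (hle : a ≤ b) :
    |gaussianDensity a z - gaussianDensity b z| ≤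
      2 ^ ((d : ℝ) / 2) * (d / κ ^ d + 2 / κ) * ((b - a) / b) * gaussianDensity (2 * b) z := by
  have ha : 0 < a := (mul_pos hκ hb).trans_le hab
  have hgb := gaussianDensity_nonneg z hb
  have hg2 := gaussianDensity_nonneg z (mul_pos two_pos hb)
  have hba : 0 ≤ (b - a) / b := div_nonneg (by linarith) hb.le
  have hrpow : (2 * Real.pi * a) ^ (-(d : ℝ) / 2) =
      (b / a) ^ ((d : ℝ) / 2) * (2 * Real.pi * b) ^ (-(d : ℝ) / 2) := by
    have h1 : 2 * Real.pi * b = b / a * (2 * Real.pi * a) := by field_simp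
    have hba' : 0 < b / a := by positivity
    rw [h1, Real.mul_rpow hba'.le (by positivity), ← mul_assoc, ← Real.rpow_add hba', neg_div,
      add_neg_cancel, Real.rpow_zero, one_mul]
  have h1ba : 1 ≤ b / a := (one_le_div ha).2 hle
  have hexp : -‖z‖ ^ 2 / (2 * a) = -‖z‖ ^ 2 / (2 * b) + -(‖z‖ ^ 2 * ((b - a) / (2 * a * b))) := by
    field_simp
    ring
  have hga : gaussianDensity a z = (b / a) ^ ((d : ℝ) / 2) *
      Real.exp (-(‖z‖ ^ 2 * ((b - a) / (2 * a * b)))) * gaussianDensity b z := by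
    rw [gaussianDensity, gaussianDensity, hrpow, hexp, Real.exp_add]
    ring
  have hpos : 0 ≤ ‖z‖ ^ 2 * ((b - a) / (2 * a * b)) :=
    mul_nonneg (by positivity) (div_nonneg (by linarith) (by positivity))
  -- The exponent `d / 2` is enlarged to the integer `d` so that Bernoulli's inequality applies to
  -- $(a/b)^d$.
  have hup : (b / a) ^ ((d : ℝ) / 2) - 1 ≤ d / κ ^ d * ((b - a) / b) := by
    have h1 : (b / a) ^ ((d : ℝ) / 2) ≤ (b / a) ^ d := by
      rw [← Real.rpow_natCast]
      exact Real.rpow_le_rpow_of_exponent_le h1ba (by linarith [(d.cast_nonneg : (0 : ℝ) ≤ d)])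
    have h2 : 1 + d * (a / b - 1) ≤ (1 + (a / b - 1)) ^ d :=
      one_add_mul_le_pow (by linarith [div_pos ha hb]) d
    have h3 : (b / a) ^ d ≤ 1 / κ ^ d := by
      rw [← one_div_pow]
      refine pow_le_pow_left₀ (by positivity) ?_ d
      rw [div_le_div_iff₀ ha hκ]
      linarith
    have h4 : (b / a) ^ d * (a / b) ^ d = 1 := by
      rw [← mul_pow, div_mul_div_cancel₀ ha.ne', div_self hb.ne', one_pow]
    have h5 : (b - a) / b = 1 - a / b := by field_simp
    rw [h5] at hba ⊢
    rw [add_sub_cancel] at h2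
    calc (b / a) ^ ((d : ℝ) / 2) - 1 ≤ (b / a) ^ d * (1 - (a / b) ^ d) := by linarith
      _ ≤ (b / a) ^ d * (d * (1 - a / b)) := by gcongr; linarith
      _ ≤ 1 / κ ^ d * (d * (1 - a / b)) := by gcongr
      _ = _ := by ring
  have hdown : ‖z‖ ^ 2 * ((b - a) / (2 * a * b)) * gaussianDensity b z ≤
      2 ^ ((d : ℝ) / 2) * (2 / κ) * ((b - a) / b) * gaussianDensity (2 * b) z := by
    have h1 := norm_sq_mul_gaussianDensity_le z hb
    have h2 : b / a ≤ 1 / κ := by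
      rw [div_le_div_iff₀ ha hκ]
      linarith
    calc _ = (‖z‖ ^ 2 * gaussianDensity b z) * ((b - a) / b) / (2 * a) := by field_simp
      _ ≤ (2 ^ ((d : ℝ) / 2) * (4 * b) * gaussianDensity (2 * b) z) * ((b - a) / b) / (2 * a) := by
        gcongr
      _ = 2 ^ ((d : ℝ) / 2) * 2 * ((b - a) / b) * gaussianDensity (2 * b) z * (b / a) := by
        field_simp
        ring
      _ ≤ 2 ^ ((d : ℝ) / 2) * 2 * ((b - a) / b) * gaussianDensity (2 * b) z * (1 / κ) := by gcongr
      _ = _ := by ring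
  have hle2 := gaussianDensity_le_two_mul z hb
  have hc : (0 : ℝ) ≤ 2 ^ ((d : ℝ) / 2) := by positivity
  rw [abs_le]
  constructor
  · have h1 : 1 - ‖z‖ ^ 2 * ((b - a) / (2 * a * b)) ≤ (b / a) ^ ((d : ℝ) / 2) *
        Real.exp (-(‖z‖ ^ 2 * ((b - a) / (2 * a * b)))) := by
      have h2 := Real.add_one_le_exp (-(‖z‖ ^ 2 * ((b - a) / (2 * a * b))))
      have h3 : 1 ≤ (b / a) ^ ((d : ℝ) / 2) := Real.one_le_rpow h1ba (by positivity)
      have h4 := le_mul_of_one_le_left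
        (Real.exp_pos (-(‖z‖ ^ 2 * ((b - a) / (2 * a * b))))).le h3
      linarith
    have h2 := mul_le_mul_of_nonneg_right h1 hgb
    rw [← hga] at h2
    have h3 : 0 ≤ 2 ^ ((d : ℝ) / 2) * (d / κ ^ d) * ((b - a) / b) * gaussianDensity (2 * b) z := by
      positivity
    linarith
  · have h1 : gaussianDensity a z ≤ (b / a) ^ ((d : ℝ) / 2) * gaussianDensity b z := by
      rw [hga]
      gcongr
      exact mul_le_of_le_one_right (by positivity) (Real.exp_le_one_iff.2 (by linarith))
    have h2 := mul_le_mul_of_nonneg_right hup hgb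
    have h3 : d / κ ^ d * ((b - a) / b) * gaussianDensity b z ≤
        d / κ ^ d * ((b - a) / b) * (2 ^ ((d : ℝ) / 2) * gaussianDensity (2 * b) z) := by gcongr
    have h4 : 0 ≤ 2 ^ ((d : ℝ) / 2) * (2 / κ) * ((b - a) / b) * gaussianDensity (2 * b) z := by
      positivity
    linarith

/-- Comparison of two Gaussian densities with different means and comparable variances. -/
lemma exists_abs_gaussianDensity_sub_sub_le (d : ℕ) (hκ : 0 < κ) :
    ∃ A : ℝ, 0 < A ∧ ∀ (a b : ℝ) (z m : EuclideanSpace ℝ (Fin d)), 0 < b → κ * b ≤ a → a ≤ b →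
      |gaussianDensity a (z - m) - gaussianDensity b z| ≤ A * (‖m‖ / √b + (b - a) / b) *
        (gaussianDensity (2 * a) (z - m) + gaussianDensity (2 * a) z + gaussianDensity (2 * b) z) := by
  refine ⟨2 ^ ((d : ℝ) / 2) * (1 / √κ) + 2 ^ ((d : ℝ) / 2) * (d / κ ^ d + 2 / κ), by positivity,
    fun a b z m hb hab hle => ?_⟩
  have ha : 0 < a := (mul_pos hκ hb).trans_le hab
  have h1 := abs_gaussianDensity_sub_sub_le z m ha
  have h2 := abs_gaussianDensity_sub_le z hκ hb hab hle
  have h3 := gaussianDensity_nonneg (z - m) (mul_pos two_pos ha)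
  have h4 := gaussianDensity_nonneg z (mul_pos two_pos ha)
  have h5 := gaussianDensity_nonneg z (mul_pos two_pos hb)
  have hba : 0 ≤ (b - a) / b := div_nonneg (by linarith) hb.le
  have h6 : ‖m‖ / √a ≤ 1 / √κ * (‖m‖ / √b) := by
    rw [div_mul_div_comm, one_mul, ← Real.sqrt_mul hκ.le]
    have : 0 < √(κ * b) := Real.sqrt_pos.2 (by positivity)
    gcongr
  refine (abs_sub_le _ (gaussianDensity a z) _).trans ?_
  have h7 : 2 ^ ((d : ℝ) / 2) * (‖m‖ / √a) *
      (gaussianDensity (2 * a) (z - m) + gaussianDensity (2 * a) z) ≤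
      2 ^ ((d : ℝ) / 2) * (1 / √κ * (‖m‖ / √b)) *
      (gaussianDensity (2 * a) (z - m) + gaussianDensity (2 * a) z) := by gcongr
  refine (add_le_add (h1.trans h7) h2).trans ?_
  set c : ℝ := 2 ^ ((d : ℝ) / 2)
  set p : ℝ := 1 / √κ
  set q : ℝ := d / κ ^ d + 2 / κ
  have hc : 0 ≤ c := by positivity
  have hp : 0 ≤ p := by positivity
  have hq : 0 ≤ q := by positivity
  have hm : 0 ≤ ‖m‖ / √b := by positivity
  generalize ‖m‖ / √b = M at *
  generalize (b - a) / b = D at *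
  generalize gaussianDensity (2 * a) (z - m) = g₁ at *
  generalize gaussianDensity (2 * a) z = g₂ at *
  generalize gaussianDensity (2 * b) z = g₃ at *
  have e : (c * p + c * q) * (M + D) * (g₁ + g₂ + g₃) - (c * (p * M) * (g₁ + g₂) + c * q * D * g₃) =
    c * p * M * g₃ + c * p * D * (g₁ + g₂ + g₃) + c * q * M * (g₁ + g₂ + g₃) +
      c * q * D * (g₁ + g₂) := by ring
  have : 0 ≤ c * p * M * g₃ + c * p * D * (g₁ + g₂ + g₃) + c * q * M * (g₁ + g₂ + g₃) +
      c * q * D * (g₁ + g₂) := by positivity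
  linarith

end Gaussian

/-! ### The fundamental solution and its pointwise distance to the limit kernel -/

section Kernels

/-- `tanh (t / 2)`, written in terms of `exp (-t)`. -/
noncomputable def halfTanh (t : ℝ) : ℝ := (1 - Real.exp (-t)) / (1 + Real.exp (-t))

lemma halfTanh_nonneg {t : ℝ} (ht : 0 ≤ t) : 0 ≤ halfTanh t :=
  div_nonneg (by linarith [Real.exp_le_one_iff.2 (neg_nonpos.2 ht)])
    (by linarith [Real.exp_pos (-t)])

lemma halfTanh_le_one (t : ℝ) : halfTanh t ≤ 1 := by
  rw [halfTanh, div_le_one (by linarith [Real.exp_pos (-t)])]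
  linarith [Real.exp_pos (-t)]

lemma halfTanh_mono {s t : ℝ} (h : s ≤ t) : halfTanh s ≤ halfTanh t := by
  have hs := Real.exp_pos (-s)
  have ht := Real.exp_pos (-t)
  have h1 : Real.exp (-t) ≤ Real.exp (-s) := Real.exp_le_exp.2 (neg_le_neg h)
  rw [halfTanh, halfTanh, div_le_div_iff₀ (by linarith) (by linarith)]
  nlinarith

/-- Half the conditional position variance has derivative $\tanh^2(t/2)$, which is what gives its
positivity and linear growth. -/
lemma hasDerivAt_sub_two_mul_halfTanh (t : ℝ) :
    HasDerivAt (fun t => t - 2 * halfTanh t) (halfTanh t ^ 2) t := by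
  have he : HasDerivAt (fun t : ℝ => Real.exp (-t)) (-Real.exp (-t)) t := by
    simpa using (hasDerivAt_neg t).exp
  have hne : 1 + Real.exp (-t) ≠ 0 := by linarith [Real.exp_pos (-t)]
  refine ((hasDerivAt_id t).sub (((he.const_sub 1).div (he.const_add 1) hne).const_mul
    2)).congr_deriv ?_
  rw [halfTanh]
  field_simp
  ring

lemma sq_halfTanh_mul_le {s t : ℝ} (hs : 0 ≤ s) (hst : s ≤ t) :
    halfTanh s ^ 2 * (t - s) ≤ (t - 2 * halfTanh t) - (s - 2 * halfTanh s) := by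
  have hd := hasDerivAt_sub_two_mul_halfTanh
  refine (convex_Ici s).mul_sub_le_image_sub_of_le_deriv
    (fun r _ => (hd r).continuousAt.continuousWithinAt)
    (fun r _ => (hd r).differentiableAt.differentiableWithinAt) (fun r hr => ?_) s
    Set.self_mem_Ici t hst hst
  rw [interior_Ici] at hr
  rw [(hd r).deriv]
  exact pow_le_pow_left₀ (halfTanh_nonneg hs) (halfTanh_mono (le_of_lt hr)) 2

/-- The position variance grows linearly away from `t = 0`. -/
lemma exists_mul_le_sub_two_mul_halfTanh {t₀ : ℝ} (ht₀ : 0 < t₀) :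
    ∃ κ, 0 < κ ∧ κ ≤ 1 ∧ ∀ t, t₀ ≤ t → κ * t ≤ t - 2 * halfTanh t := by
  have hq : Real.exp (-(t₀ / 2)) < 1 := Real.exp_zero ▸ Real.exp_lt_exp.2 (by linarith)
  have hpos : 0 < halfTanh (t₀ / 2) :=
    div_pos (by linarith) (by linarith [Real.exp_pos (-(t₀ / 2))])
  have h1 := halfTanh_le_one (t₀ / 2)
  -- Beyond $t_0/2$ the growth rate is at least $\tanh^2(t_0/4)$, and $t-t_0/2\ge t/2$ costs the
  -- factor $1/2$.
  refine ⟨halfTanh (t₀ / 2) ^ 2 / 2, by positivity, by nlinarith, fun t ht => ?_⟩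
  have h2 := sq_halfTanh_mul_le (s := t₀ / 2) (by linarith) (by linarith : t₀ / 2 ≤ t)
  have h3 := sq_halfTanh_mul_le le_rfl (by linarith : (0 : ℝ) ≤ t₀ / 2)
  have h4 : halfTanh 0 = 0 := by simp [halfTanh]
  rw [h4] at h3
  nlinarith [sq_nonneg (halfTanh (t₀ / 2))]

variable {d : ℕ}

local notation "V" => EuclideanSpace ℝ (Fin d)

/-- The fundamental solution of the kinetic Fokker–Planck equation, as a function of the
final state `z` and the initial state `z₀`: the product of the velocity marginal and the
conditional law of the position. -/
noncomputable def kfpKernel (t : ℝ) (z z₀ : V × V) : ℝ :=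
  gaussianDensity (1 - Real.exp (-t) ^ 2) (z.2 - Real.exp (-t) • z₀.2) *
    gaussianDensity (2 * (t - 2 * halfTanh t)) (z.1 - z₀.1 - halfTanh t • (z.2 + z₀.2))

/-- The heat kernel in the position variable times the Maxwellian in the velocity variable. -/
noncomputable def heatMaxwellKernel (t : ℝ) (z z₀ : V × V) : ℝ :=
  gaussianDensity (2 * t) (z.1 - z₀.1) * gaussianDensity 1 z.2

/-- Tonelli for a velocity density `P` times position densities `Γ` whose centre may depend on
velocity: a sup bound and a mass bound on `Γ` give the $L^\infty_xL^1_v$ and $L^1_xL^1_v$ bounds. -/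
lemma lintegral_mul_le_and_lintegral_lintegral_mul_le {X Y : Type*} [MeasurableSpace X]
    [MeasurableSpace Y] {μ : Measure X} {ν : Measure Y} [SFinite μ] [SFinite ν] {P : Y → ℝ≥0∞}
    {Γ : X → Y → ℝ≥0∞} {p g S : ℝ≥0∞} (hP : Measurable P) (hΓ : Measurable Γ.uncurry)
    (hp : ∫⁻ y, P y ∂ν ≤ p) (hS : ∀ x y, Γ x y ≤ S) (hg : ∀ y, ∫⁻ x, Γ x y ∂μ ≤ g) :
    (∀ x, ∫⁻ y, P y * Γ x y ∂ν ≤ p * S) ∧ ∫⁻ x, ∫⁻ y, P y * Γ x y ∂ν ∂μ ≤ p * g := by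
  refine ⟨fun x => ?_, ?_⟩
  · calc _ ≤ ∫⁻ y, P y * S ∂ν := lintegral_mono fun y => mul_le_mul_right (hS x y) _
      _ = (∫⁻ y, P y ∂ν) * S := lintegral_mul_const _ hP
      _ ≤ _ := mul_le_mul_left hp _
  · rw [lintegral_lintegral_swap ((hP.comp measurable_snd).mul hΓ).aemeasurable]
    calc _ = ∫⁻ y, P y * ∫⁻ x, Γ x y ∂μ ∂ν := lintegral_congr fun y =>
          lintegral_const_mul _ (hΓ.comp measurable_prodMk_right)
      _ ≤ ∫⁻ y, P y * g ∂ν := lintegral_mono fun y => mul_le_mul_right (hg y) _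
      _ = (∫⁻ y, P y ∂ν) * g := lintegral_mul_const _ hP
      _ ≤ _ := mul_le_mul_left hp _

lemma sqrt_mul_exp_neg_le_one {t : ℝ} (ht : 0 ≤ t) : √t * Real.exp (-t) ≤ 1 := by
  have h1 := Real.add_one_le_exp t
  have h2 : √t ≤ t + 1 := by nlinarith [Real.sq_sqrt ht, sq_nonneg (√t - 1), Real.sqrt_nonneg t]
  rw [Real.exp_neg, ← div_eq_mul_inv, div_le_one (Real.exp_pos _)]
  linarith

/-- Telescoping: change the position factor first, with the kinetic velocity law as weight, then the
velocity factor. The bound keeps full Gaussians in both variables, so it can be integrated in `v`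
and then bounded or integrated in `x`. -/
lemma exists_abs_kfpKernel_sub_le {t₀ κ : ℝ} (ht₀ : 0 < t₀) (hκ : 0 < κ)
    (hκt : ∀ t, t₀ ≤ t → κ * t ≤ t - 2 * halfTanh t) :
    ∃ C, 0 < C ∧ ∀ t, t₀ ≤ t → ∀ x v y w : V,
      |kfpKernel t (x, v) (y, w) - heatMaxwellKernel t (x, v) (y, w)| ≤
        C * (1 + ‖w‖) / √t * (
          (gaussianDensity (2 * (1 - Real.exp (-t) ^ 2)) (v - Real.exp (-t) • w) +
            gaussianDensity (1 - Real.exp (-t) ^ 2) (v - Real.exp (-t) • w)) *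
          (gaussianDensity (2 * (2 * (t - 2 * halfTanh t))) (x - y - halfTanh t • (v + w)) +
            gaussianDensity (2 * (2 * (t - 2 * halfTanh t))) (x - y) +
            gaussianDensity (2 * (2 * t)) (x - y)) +
          (gaussianDensity (2 * (1 - Real.exp (-t) ^ 2)) (v - Real.exp (-t) • w) +
            gaussianDensity (2 * (1 - Real.exp (-t) ^ 2)) v + gaussianDensity (2 * 1) v) *
          gaussianDensity (2 * t) (x - y)) := by
  have hq₀ : 0 < 1 - Real.exp (-t₀) ^ 2 := by
    have h1 : Real.exp (-t₀) < 1 := Real.exp_zero ▸ Real.exp_lt_exp.2 (by linarith)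
    nlinarith [Real.exp_pos (-t₀)]
  obtain ⟨A, hA, hA'⟩ := exists_abs_gaussianDensity_sub_sub_le d hκ
  obtain ⟨B, hB, hB'⟩ := exists_abs_gaussianDensity_sub_sub_le d hq₀
  have hst₀ : 0 < √t₀ := Real.sqrt_pos.2 ht₀
  refine ⟨A * (2 ^ ((d : ℝ) / 2) + 2 + 2 / √t₀) + B, by positivity, fun t ht x v y w => ?_⟩
  have htpos : 0 < t := ht₀.trans_le ht
  have hst : 0 < √t := Real.sqrt_pos.2 htpos
  have hs0 := halfTanh_nonneg htpos.le
  have hs1 := halfTanh_le_one t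
  have hA2 := hA' (2 * (t - 2 * halfTanh t)) (2 * t) (x - y) (halfTanh t • (v + w))
    (by linarith) (by linarith [hκt t ht]) (by linarith)
  have hqpos := Real.exp_pos (-t)
  have hq1 : Real.exp (-t) ≤ Real.exp (-t₀) := Real.exp_le_exp.2 (neg_le_neg ht)
  have hq2 : Real.exp (-t) ^ 2 ≤ Real.exp (-t₀) ^ 2 := by gcongr
  have hqt := sqrt_mul_exp_neg_le_one htpos.le
  have hB2 := hB' (1 - Real.exp (-t) ^ 2) 1 v (Real.exp (-t) • w) one_pos (by linarith)
    (by linarith [sq_nonneg (Real.exp (-t))])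
  have hτ : 0 < 2 * (t - 2 * halfTanh t) := by
    have := hκt t ht
    have : 0 < κ * t := by positivity
    linarith
  have hmom := norm_mul_gaussianDensity_le (a := 1 - Real.exp (-t) ^ 2)
    (v - Real.exp (-t) • w) (by linarith)
  have hσ1 : √(1 - Real.exp (-t) ^ 2) ≤ 1 := Real.sqrt_le_one.2 (by linarith [sq_nonneg (Real.exp (-t))])
  have hqle : Real.exp (-t) ≤ 1 := Real.exp_le_one_iff.2 (by linarith)
  -- The shift is expressed through the centred velocity because that is the factor the velocity
  -- Gaussian can absorb.
  have hshift : ‖halfTanh t • (v + w)‖ ≤ ‖v - Real.exp (-t) • w‖ + 2 * ‖w‖ := by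
    have h1 : v + w = (v - Real.exp (-t) • w) + (1 + Real.exp (-t)) • w := by
      rw [add_smul, one_smul]; abel
    rw [norm_smul, Real.norm_eq_abs, abs_of_nonneg hs0]
    refine (mul_le_of_le_one_left (norm_nonneg _) hs1).trans ?_
    rw [h1]
    refine (norm_add_le _ _).trans ?_
    rw [norm_smul, Real.norm_eq_abs, abs_of_nonneg (by linarith)]
    gcongr
    linarith
  -- The relative variance defect is $2\tanh(t/2)/t\le 2/t$; one factor $t^{-1/2}$ is traded for
  -- $t_0^{-1/2}$.
  have hx : ‖halfTanh t • (v + w)‖ / √(2 * t) + (2 * t - 2 * (t - 2 * halfTanh t)) / (2 * t) ≤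
      (‖v - Real.exp (-t) • w‖ + 2 * ‖w‖ + 2 / √t₀) / √t := by
    rw [add_div _ (2 / √t₀)]
    refine add_le_add ?_ ?_
    · gcongr
      linarith
    · have h1 : √t * √t = t := Real.mul_self_sqrt htpos.le
      have h2 : √t₀ ≤ √t := Real.sqrt_le_sqrt ht
      calc _ = 2 * halfTanh t / t := by field_simp; ring
        _ ≤ 2 / t := by gcongr; linarith
        _ = 2 / √t / √t := by rw [div_div, h1]
        _ ≤ _ := by gcongr
  have hv : ‖Real.exp (-t) • w‖ / √1 + (1 - (1 - Real.exp (-t) ^ 2)) / 1 ≤ (1 + ‖w‖) / √t := by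
    rw [norm_smul, Real.norm_eq_abs, abs_of_pos hqpos, Real.sqrt_one, div_one, div_one,
      le_div_iff₀ hst]
    nlinarith [norm_nonneg w]
  have hg1 := gaussianDensity_nonneg (a := 1 - Real.exp (-t) ^ 2) (v - Real.exp (-t) • w)
    (by linarith)
  have hg2 := gaussianDensity_nonneg (a := 2 * (1 - Real.exp (-t) ^ 2)) (v - Real.exp (-t) • w)
    (by linarith)
  have hg3 := gaussianDensity_nonneg (a := 2 * (1 - Real.exp (-t) ^ 2)) v (by linarith)
  have hg4 := gaussianDensity_nonneg (a := 2 * 1) v (by norm_num)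
  have hg5 := gaussianDensity_nonneg (a := 2 * t) (x - y) (by linarith)
  have hg6 := gaussianDensity_nonneg (a := 2 * (2 * t)) (x - y) (by linarith)
  have hg7 := gaussianDensity_nonneg (x - y) (mul_pos two_pos hτ)
  have hg8 := gaussianDensity_nonneg (x - y - halfTanh t • (v + w)) (mul_pos two_pos hτ)
  have hc : (0 : ℝ) ≤ 2 ^ ((d : ℝ) / 2) := by positivity
  have hw := norm_nonneg w
  have hvel : gaussianDensity (1 - Real.exp (-t) ^ 2) (v - Real.exp (-t) • w) *
      (‖v - Real.exp (-t) • w‖ + 2 * ‖w‖ + 2 / √t₀) ≤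
      (2 ^ ((d : ℝ) / 2) + 2 + 2 / √t₀) * (1 + ‖w‖) *
        (gaussianDensity (2 * (1 - Real.exp (-t) ^ 2)) (v - Real.exp (-t) • w) +
          gaussianDensity (1 - Real.exp (-t) ^ 2) (v - Real.exp (-t) • w)) := by
    have h1 : 2 ^ ((d : ℝ) / 2) * √(1 - Real.exp (-t) ^ 2) *
        gaussianDensity (2 * (1 - Real.exp (-t) ^ 2)) (v - Real.exp (-t) • w) ≤
        2 ^ ((d : ℝ) / 2) *
        gaussianDensity (2 * (1 - Real.exp (-t) ^ 2)) (v - Real.exp (-t) • w) := by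
      gcongr
      exact mul_le_of_le_one_right hc hσ1
    have h2 := hmom.trans h1
    have h3 : 0 ≤ 2 / √t₀ := by positivity
    generalize gaussianDensity (1 - Real.exp (-t) ^ 2) (v - Real.exp (-t) • w) = g at *
    generalize gaussianDensity (2 * (1 - Real.exp (-t) ^ 2)) (v - Real.exp (-t) • w) = g' at *
    generalize (2 : ℝ) ^ ((d : ℝ) / 2) = c at *
    generalize 2 / √t₀ = r at *
    generalize ‖w‖ = n at *
    have e : (c + 2 + r) * (1 + n) * (g' + g) - (c * g' + g * (2 * n + r)) =
      c * n * g' + (2 + r) * (1 + n) * g' + c * (1 + n) * g + 2 * g + r * n * g := by ring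
    have : 0 ≤ c * n * g' + (2 + r) * (1 + n) * g' + c * (1 + n) * g + 2 * g + r * n * g := by
      positivity
    linarith
  have hmain : |kfpKernel t (x, v) (y, w) - heatMaxwellKernel t (x, v) (y, w)| ≤
      gaussianDensity (1 - Real.exp (-t) ^ 2) (v - Real.exp (-t) • w) *
        |gaussianDensity (2 * (t - 2 * halfTanh t)) (x - y - halfTanh t • (v + w)) -
          gaussianDensity (2 * t) (x - y)| + gaussianDensity (2 * t) (x - y) *
        |gaussianDensity (1 - Real.exp (-t) ^ 2) (v - Real.exp (-t) • w) -
          gaussianDensity 1 v| := by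
    rw [← abs_of_nonneg hg1, ← abs_of_nonneg hg5, ← abs_mul, ← abs_mul, abs_of_nonneg hg1,
      abs_of_nonneg hg5]
    refine le_of_eq_of_le (congrArg abs ?_) (abs_add_le _ _)
    simp only [kfpKernel, heatMaxwellKernel]
    ring
  refine hmain.trans ?_
  have hΓ : 0 ≤ gaussianDensity (2 * (2 * (t - 2 * halfTanh t))) (x - y - halfTanh t • (v + w)) +
    gaussianDensity (2 * (2 * (t - 2 * halfTanh t))) (x - y) +
    gaussianDensity (2 * (2 * t)) (x - y) := by positivity
  have hΓ' : 0 ≤ gaussianDensity (2 * (1 - Real.exp (-t) ^ 2)) (v - Real.exp (-t) • w) +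
    gaussianDensity (2 * (1 - Real.exp (-t) ^ 2)) v + gaussianDensity (2 * 1) v := by positivity
  have hP : 0 ≤ gaussianDensity (2 * (1 - Real.exp (-t) ^ 2)) (v - Real.exp (-t) • w) +
    gaussianDensity (1 - Real.exp (-t) ^ 2) (v - Real.exp (-t) • w) := by positivity
  have hA3 := hA2.trans (mul_le_mul_of_nonneg_right (mul_le_mul_of_nonneg_left hx hA.le) hΓ)
  have hB3 := hB2.trans (mul_le_mul_of_nonneg_right (mul_le_mul_of_nonneg_left hv hB.le) hΓ')
  have hA4 := mul_le_mul_of_nonneg_left hA3 hg1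
  have hB4 := mul_le_mul_of_nonneg_left hB3 hg5
  have hvel' := mul_le_mul_of_nonneg_right hvel (mul_nonneg (div_nonneg hA.le hst.le) hΓ)
  refine (add_le_add hA4 hB4).trans ?_
  have hcr : 0 ≤ (2 : ℝ) ^ ((d : ℝ) / 2) + 2 + 2 / √t₀ := by positivity
  generalize gaussianDensity (2 * (2 * (t - 2 * halfTanh t))) (x - y - halfTanh t • (v + w)) +
    gaussianDensity (2 * (2 * (t - 2 * halfTanh t))) (x - y) +
    gaussianDensity (2 * (2 * t)) (x - y) = Γ at *
  generalize gaussianDensity (2 * (1 - Real.exp (-t) ^ 2)) (v - Real.exp (-t) • w) +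
    gaussianDensity (2 * (1 - Real.exp (-t) ^ 2)) v + gaussianDensity (2 * 1) v = Γ' at *
  generalize gaussianDensity (2 * (1 - Real.exp (-t) ^ 2)) (v - Real.exp (-t) • w) +
    gaussianDensity (1 - Real.exp (-t) ^ 2) (v - Real.exp (-t) • w) = P at *
  generalize gaussianDensity (1 - Real.exp (-t) ^ 2) (v - Real.exp (-t) • w) = g at *
  generalize gaussianDensity (2 * t) (x - y) = h at *
  generalize (2 : ℝ) ^ ((d : ℝ) / 2) + 2 + 2 / √t₀ = c at *
  have e : A * c * Γ' * h * ((1 + ‖w‖) / √t) + B * P * Γ * ((1 + ‖w‖) / √t) =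
      (A * c + B) * (1 + ‖w‖) / √t * (P * Γ + Γ' * h) -
        (c * (1 + ‖w‖) * P * (A / √t * Γ) + h * (B * ((1 + ‖w‖) / √t) * Γ')) := by ring
  have hpos : 0 ≤ A * c * Γ' * h * ((1 + ‖w‖) / √t) + B * P * Γ * ((1 + ‖w‖) / √t) := by positivity
  have e2 : g * (A * ((‖v - Real.exp (-t) • w‖ + 2 * ‖w‖ + 2 / √t₀) / √t) * Γ) =
    g * (‖v - Real.exp (-t) • w‖ + 2 * ‖w‖ + 2 / √t₀) * (A / √t * Γ) := by ring
  rw [e2]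
  linarith

end Kernels

/-! ### Integrated kernel bounds -/

section KernelBounds

variable {d : ℕ}

local notation "V" => EuclideanSpace ℝ (Fin d)

lemma gaussianDensity_le_of_le {a b : ℝ} (ha : 0 < a) (hab : a ≤ b) (z : V) :
    gaussianDensity b z ≤ (2 * Real.pi * a) ^ (-(d : ℝ) / 2) := by
  refine (gaussianDensity_le z (ha.trans_le hab)).trans ?_
  refine Real.rpow_le_rpow_of_nonpos (by positivity) (by gcongr) ?_
  exact div_nonpos_of_nonpos_of_nonneg (by simp) (by simp)

lemma ofReal_mul_add_mul {L p₁ p₂ g₁ g₂ g₃ q₁ q₂ q₃ h : ℝ} (hL : 0 ≤ L) (hp₁ : 0 ≤ p₁)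
    (hp₂ : 0 ≤ p₂) (hg₁ : 0 ≤ g₁) (hg₂ : 0 ≤ g₂) (hg₃ : 0 ≤ g₃) (hq₁ : 0 ≤ q₁) (hq₂ : 0 ≤ q₂)
    (hq₃ : 0 ≤ q₃) (hh : 0 ≤ h) :
    ENNReal.ofReal (L * ((p₁ + p₂) * (g₁ + g₂ + g₃) + (q₁ + q₂ + q₃) * h)) =
      ENNReal.ofReal L * ((ENNReal.ofReal p₁ + ENNReal.ofReal p₂) *
        (ENNReal.ofReal g₁ + ENNReal.ofReal g₂ + ENNReal.ofReal g₃) +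
        (ENNReal.ofReal q₁ + ENNReal.ofReal q₂ + ENNReal.ofReal q₃) * ENNReal.ofReal h) := by
  lift L to ℝ≥0 using hL
  lift p₁ to ℝ≥0 using hp₁
  lift p₂ to ℝ≥0 using hp₂
  lift g₁ to ℝ≥0 using hg₁
  lift g₂ to ℝ≥0 using hg₂
  lift g₃ to ℝ≥0 using hg₃
  lift q₁ to ℝ≥0 using hq₁
  lift q₂ to ℝ≥0 using hq₂
  lift q₃ to ℝ≥0 using hq₃
  lift h to ℝ≥0 using hh
  norm_cast
  simp only [ENNReal.ofReal_coe_nnreal]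
  norm_cast

lemma lintegral_le_and_lintegral_lintegral_le_of_le_mul_add {X Y : Type*} [MeasurableSpace X]
    [MeasurableSpace Y] {μ : Measure X} {ν : Measure Y} [SFinite ν] {K A B : X → Y → ℝ≥0∞}
    {L a b a' b' : ℝ≥0∞} (hA : Measurable A.uncurry) (hB : Measurable B.uncurry)
    (hK : ∀ x y, K x y ≤ L * (A x y + B x y))
    (ha : (∀ x, ∫⁻ y, A x y ∂ν ≤ a) ∧ ∫⁻ x, ∫⁻ y, A x y ∂ν ∂μ ≤ a')
    (hb : (∀ x, ∫⁻ y, B x y ∂ν ≤ b) ∧ ∫⁻ x, ∫⁻ y, B x y ∂ν ∂μ ≤ b') :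
    (∀ x, ∫⁻ y, K x y ∂ν ≤ L * (a + b)) ∧ ∫⁻ x, ∫⁻ y, K x y ∂ν ∂μ ≤ L * (a' + b') := by
  have hin : ∀ x, ∫⁻ y, K x y ∂ν ≤ L * (∫⁻ y, A x y ∂ν + ∫⁻ y, B x y ∂ν) := fun x => by
    have hAx : Measurable (A x) := hA.comp measurable_prodMk_left
    have hBx : Measurable (B x) := hB.comp measurable_prodMk_left
    have hABx : Measurable fun y => A x y + B x y := hAx.add hBx
    rw [← lintegral_add_left hAx, ← lintegral_const_mul _ hABx]
    exact lintegral_mono (hK x)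
  refine ⟨fun x => (hin x).trans (mul_le_mul_right (add_le_add (ha.1 x) (hb.1 x)) _), ?_⟩
  refine (lintegral_mono hin).trans ?_
  have hAi : Measurable fun x => ∫⁻ y, A x y ∂ν := hA.lintegral_prod_right'
  have hBi : Measurable fun x => ∫⁻ y, B x y ∂ν := hB.lintegral_prod_right'
  have hABi : Measurable fun x => ∫⁻ y, A x y ∂ν + ∫⁻ y, B x y ∂ν := hAi.add hBi
  rw [lintegral_const_mul _ hABi, lintegral_add_left hAi]
  exact mul_le_mul_right (add_le_add ha.2 hb.2) _

/-- The two kernels differ by `O(t^{-1/2})` in `L¹_x L¹_v`, and by `O(t^{-d/2} t^{-1/2})` in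
`L^∞_x L¹_v`. -/
theorem exists_lintegral_kernel_sub_le {t₀ : ℝ} (ht₀ : 0 < t₀) :
    ∃ C, 0 < C ∧ ∀ t, t₀ ≤ t → ∀ z₀ : V × V,
      (∀ x, ∫⁻ v, ‖kfpKernel t (x, v) z₀ - heatMaxwellKernel t (x, v) z₀‖ₑ ≤
        ENNReal.ofReal (C * (1 + ‖z₀.2‖) / √t * t ^ (-(d : ℝ) / 2))) ∧
      ∫⁻ x, ∫⁻ v, ‖kfpKernel t (x, v) z₀ - heatMaxwellKernel t (x, v) z₀‖ₑ ≤
        ENNReal.ofReal (C * (1 + ‖z₀.2‖) / √t) := by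
  obtain ⟨κ, hκ, hκ1, hκt⟩ := exists_mul_le_sub_two_mul_halfTanh ht₀
  obtain ⟨C, hC, hbound⟩ := exists_abs_kfpKernel_sub_le (d := d) ht₀ hκ hκt
  -- Every position Gaussian in the bound has variance at least $2\kappa t$ (using $\kappa\le1$),
  -- hence height at most $c\,t^{-d/2}$.
  set c : ℝ := (4 * Real.pi * κ) ^ (-(d : ℝ) / 2)
  have hc : 0 < c := by positivity
  -- $9=2\cdot3+3\cdot1$ counts the products of unit-mass Gaussians; `c + 1` serves the sup bound
  -- and the mass bound at once.
  refine ⟨C * 9 * (c + 1), by positivity, fun t ht z₀ => ?_⟩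
  obtain ⟨y, w⟩ := z₀
  have htpos : 0 < t := ht₀.trans_le ht
  have hst : 0 < √t := Real.sqrt_pos.2 htpos
  have hκtpos : 0 < 2 * κ * t := by positivity
  have hτ := hκt t ht
  have hσ : 0 < 1 - Real.exp (-t) ^ 2 := by
    have h1 : Real.exp (-t) < 1 := Real.exp_zero ▸ Real.exp_lt_exp.2 (by linarith)
    nlinarith [Real.exp_pos (-t)]
  have hsup : ∀ b, 2 * κ * t ≤ b → ∀ z : V, ENNReal.ofReal (gaussianDensity b z) ≤
      ENNReal.ofReal (c * t ^ (-(d : ℝ) / 2)) := fun b hb z => by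
    refine ENNReal.ofReal_le_ofReal ((gaussianDensity_le_of_le hκtpos hb z).trans_eq ?_)
    rw [← Real.mul_rpow (by positivity) htpos.le]
    ring_nf
  set S : ℝ≥0∞ := ENNReal.ofReal (c * t ^ (-(d : ℝ) / 2))
  let P : V → ℝ≥0∞ := fun v =>
    ENNReal.ofReal (gaussianDensity (2 * (1 - Real.exp (-t) ^ 2)) (v - Real.exp (-t) • w)) +
      ENNReal.ofReal (gaussianDensity (1 - Real.exp (-t) ^ 2) (v - Real.exp (-t) • w))
  let Γ : V → V → ℝ≥0∞ := fun x v =>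
    ENNReal.ofReal (gaussianDensity (2 * (2 * (t - 2 * halfTanh t)))
      (x - y - halfTanh t • (v + w))) +
    ENNReal.ofReal (gaussianDensity (2 * (2 * (t - 2 * halfTanh t))) (x - y)) +
    ENNReal.ofReal (gaussianDensity (2 * (2 * t)) (x - y))
  let P' : V → ℝ≥0∞ := fun v =>
    ENNReal.ofReal (gaussianDensity (2 * (1 - Real.exp (-t) ^ 2)) (v - Real.exp (-t) • w)) +
      ENNReal.ofReal (gaussianDensity (2 * (1 - Real.exp (-t) ^ 2)) v) +
      ENNReal.ofReal (gaussianDensity (2 * 1) v)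
  let Γ' : V → V → ℝ≥0∞ := fun x _ => ENNReal.ofReal (gaussianDensity (2 * t) (x - y))
  have hPm : Measurable P := by fun_prop
  have hP'm : Measurable P' := by fun_prop
  have hgm : ∀ (b : ℝ) {g : V × V → V}, Continuous g →
      Measurable fun p => ENNReal.ofReal (gaussianDensity b (g p)) := fun b g hg =>
    ((continuous_gaussianDensity b).comp hg).measurable.ennreal_ofReal
  have hΓm : Measurable Γ.uncurry :=
    ((hgm _ (by fun_prop)).add (hgm _ (by fun_prop))).add (hgm _ (by fun_prop))
  have hΓ'm : Measurable Γ'.uncurry := hgm _ (by fun_prop)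
  have h1 := lintegral_mul_le_and_lintegral_lintegral_mul_le (μ := volume) (ν := volume)
    (p := 2) (g := 3) (S := 3 * S) hPm hΓm
    (by
      rw [lintegral_add_left (by fun_prop), lintegral_gaussianDensity_sub _ (by linarith),
        lintegral_gaussianDensity_sub _ hσ]
      norm_num)
    (fun x v => by
      refine (add_le_add (add_le_add (hsup _ ?_ _) (hsup _ ?_ _)) (hsup _ ?_ _)).trans_eq ?_
      · linarith
      · linarith
      · nlinarith
      · ring)
    (fun v => by
      simp only [Γ, sub_sub]
      rw [lintegral_add_left (by fun_prop), lintegral_add_left (by fun_prop),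
        lintegral_gaussianDensity_sub _ (by linarith),
        lintegral_gaussianDensity_sub _ (by linarith),
        lintegral_gaussianDensity_sub _ (by linarith)]
      norm_num)
  have h2 := lintegral_mul_le_and_lintegral_lintegral_mul_le (μ := volume) (ν := volume)
    (p := 3) (g := 1) (S := S) hP'm hΓ'm
    (by
      rw [lintegral_add_left (by fun_prop), lintegral_add_left (by fun_prop),
        lintegral_gaussianDensity_sub _ (by linarith), lintegral_gaussianDensity (by linarith),
        lintegral_gaussianDensity (by norm_num)]
      norm_num)
    (fun x v => hsup _ (by nlinarith) _)
    (fun v => (lintegral_gaussianDensity_sub _ (by linarith)).le)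
  set L : ℝ := C * (1 + ‖w‖) / √t
  have hL : 0 ≤ L := by positivity
  have hpt : ∀ x v, ‖kfpKernel t (x, v) (y, w) - heatMaxwellKernel t (x, v) (y, w)‖ₑ ≤
      ENNReal.ofReal L * (P v * Γ x v + P' v * Γ' x v) := fun x v => by
    have hn : ∀ {b : ℝ} (z : V), 0 < b → 0 ≤ gaussianDensity b z := fun z hb =>
      gaussianDensity_nonneg z hb
    have n1 := hn (b := 2 * (1 - Real.exp (-t) ^ 2)) (v - Real.exp (-t) • w) (by linarith)
    have n2 := hn (v - Real.exp (-t) • w) hσ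
    have n3 := hn (b := 2 * (2 * (t - 2 * halfTanh t))) (x - y - halfTanh t • (v + w))
      (by linarith)
    have n4 := hn (b := 2 * (2 * (t - 2 * halfTanh t))) (x - y) (by linarith)
    have n5 := hn (b := 2 * (2 * t)) (x - y) (by linarith)
    have n6 := hn (b := 2 * (1 - Real.exp (-t) ^ 2)) v (by linarith)
    have n7 := hn (b := 2 * 1) v (by norm_num)
    have n8 := hn (b := 2 * t) (x - y) (by linarith)
    rw [Real.enorm_eq_ofReal_abs]
    refine (ENNReal.ofReal_le_ofReal (hbound t ht x v y w)).trans_eq ?_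
    exact ofReal_mul_add_mul hL n1 n2 n3 n4 n5 n1 n6 n7 n8
  obtain ⟨h3, h4⟩ := lintegral_le_and_lintegral_lintegral_le_of_le_mul_add
    ((hPm.comp measurable_snd).mul hΓm) ((hP'm.comp measurable_snd).mul hΓ'm) hpt h1 h2
  have h9 : ENNReal.ofReal 9 = 9 := by simp
  constructor
  · intro x
    refine (h3 x).trans ?_
    have e : (2 * (3 * S) + 3 * S : ℝ≥0∞) = ENNReal.ofReal (9 * (c * t ^ (-(d : ℝ) / 2))) := by
      rw [ENNReal.ofReal_mul (by norm_num), h9]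
      ring
    rw [e, ← ENNReal.ofReal_mul hL]
    refine ENNReal.ofReal_le_ofReal ?_
    have : 0 ≤ L * 9 * t ^ (-(d : ℝ) / 2) := by positivity
    calc _ ≤ L * (9 * (c * t ^ (-(d : ℝ) / 2))) + L * 9 * t ^ (-(d : ℝ) / 2) := by linarith
      _ = _ := by
        simp only [L]
        ring
  · refine h4.trans ?_
    have e : (2 * 3 + 3 * 1 : ℝ≥0∞) = ENNReal.ofReal 9 := by rw [h9]; norm_num
    rw [e, ← ENNReal.ofReal_mul hL]
    refine ENNReal.ofReal_le_ofReal ?_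
    have : 0 ≤ L * 9 * c := by positivity
    calc _ ≤ L * 9 * c + L * 9 := by linarith
      _ = _ := by
        simp only [L]
        ring

end KernelBounds

/-- Interpolation of an `L^p` bound between `L¹` and `L^∞`. -/
lemma eLpNorm_le_of_le_of_lintegral_le {α : Type*} [MeasurableSpace α] {μ : Measure α}
    {F : α → ℝ≥0∞} {L S : ℝ} (hL : 0 < L) (hS : 0 < S) {p : ℝ≥0∞} (hp : 1 ≤ p)
    (hsup : ∀ x, F x ≤ ENNReal.ofReal (L * S)) (hint : ∫⁻ x, F x ∂μ ≤ ENNReal.ofReal L) :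
    eLpNorm F p μ ≤ ENNReal.ofReal (L * S ^ (1 - (p⁻¹).toReal)) := by
  rcases eq_or_ne p ∞ with rfl | hpt
  · simp only [ENNReal.inv_top, ENNReal.toReal_zero, sub_zero, Real.rpow_one,
      eLpNorm_exponent_top]
    exact eLpNormEssSup_le_of_ae_enorm_bound (ae_of_all _ hsup)
  have hr : 1 ≤ p.toReal := by
    rw [← ENNReal.toReal_one]
    exact ENNReal.toReal_mono hpt hp
  have hr0 : 0 < p.toReal := by linarith
  have hLS : 0 < L * S := mul_pos hL hS
  rw [eLpNorm_eq_lintegral_rpow_enorm_toReal (by positivity) hpt, ENNReal.toReal_inv]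
  set r := p.toReal
  have h1 : ∫⁻ x, ‖F x‖ₑ ^ r ∂μ ≤ ENNReal.ofReal ((L * S) ^ (r - 1) * L) := by
    rw [ENNReal.ofReal_mul (by positivity), ← ENNReal.ofReal_rpow_of_nonneg hLS.le (by linarith)]
    calc ∫⁻ x, ‖F x‖ₑ ^ r ∂μ ≤ ∫⁻ x, ENNReal.ofReal (L * S) ^ (r - 1) * F x ∂μ := by
          refine lintegral_mono fun x => ?_
          have h2 : r = (r - 1) + 1 := by ring
          rw [enorm_eq_self]
          nth_rw 1 [h2]
          rw [ENNReal.rpow_add_of_nonneg _ _ (by linarith) zero_le_one, ENNReal.rpow_one]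
          exact mul_le_mul_left (ENNReal.rpow_le_rpow (hsup x) (by linarith)) _
      _ = ENNReal.ofReal (L * S) ^ (r - 1) * ∫⁻ x, F x ∂μ :=
          lintegral_const_mul' _ _ (ENNReal.rpow_ne_top_of_nonneg (by linarith)
            ENNReal.ofReal_ne_top)
      _ ≤ _ := by gcongr
  refine (ENNReal.rpow_le_rpow h1 (by positivity)).trans_eq ?_
  rw [ENNReal.ofReal_rpow_of_nonneg (by positivity) (by positivity)]
  congr 1
  have h3 : (L * S) ^ (r - 1) * L = L ^ r * S ^ (r - 1) := by
    rw [Real.mul_rpow hL.le hS.le, mul_right_comm, ← Real.rpow_add_one hL.ne', sub_add_cancel]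
  rw [h3, Real.mul_rpow (by positivity) (by positivity), ← Real.rpow_mul hL.le,
    ← Real.rpow_mul hS.le, mul_one_div_cancel hr0.ne', Real.rpow_one]
  congr 2
  field_simp

/-! ### Superpositions of probability kernels -/

section Mixtures

variable {E F : Type*} [MeasurableSpace E] [MeasurableSpace F] {μ : Measure E} {ν : Measure F}
  [SFinite μ] [SFinite ν] {k : E → F → ℝ} {f₀ : F → ℝ}

/-- Averaging a family of probability densities against an integrable function. -/
lemma integrable_mixture (hk : Measurable k.uncurry) (h0 : ∀ z z₀, 0 ≤ k z z₀)
    (h1 : ∀ z₀, ∫⁻ z, ENNReal.ofReal (k z z₀) ∂μ = 1) (hf₀ : Integrable f₀ ν) :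
    Integrable (fun p : E × F => k p.1 p.2 * f₀ p.2) (μ.prod ν) := by
  have hm : AEStronglyMeasurable (fun p : E × F => k p.1 p.2 * f₀ p.2) (μ.prod ν) :=
    hk.aestronglyMeasurable.mul hf₀.aestronglyMeasurable.comp_snd
  refine ⟨hm, ?_⟩
  rw [HasFiniteIntegral, lintegral_prod_symm _ hm.enorm]
  refine (lintegral_congr fun z₀ => ?_).trans_lt hf₀.2
  have h2 : ∀ z, ‖k z z₀ * f₀ z₀‖ₑ = ENNReal.ofReal (k z z₀) * ‖f₀ z₀‖ₑ := fun z => by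
    rw [enorm_mul, Real.enorm_of_nonneg (h0 z z₀)]
  simp only [h2]
  rw [lintegral_mul_const' _ _ enorm_ne_top, h1, one_mul]

/-- Fubini; with `φ` a cosine, the Fourier transform of a mixture is the mixture of the kernel
transforms. -/
lemma integral_mixture_mul (hk : Measurable k.uncurry) (h0 : ∀ z z₀, 0 ≤ k z z₀)
    (h1 : ∀ z₀, ∫⁻ z, ENNReal.ofReal (k z z₀) ∂μ = 1) (hf₀ : Integrable f₀ ν) {φ : E → ℝ} {K : ℝ}
    (hφ : Measurable φ) (hK : ∀ z, |φ z| ≤ K) :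
    ∫ z, (∫ z₀, k z z₀ * f₀ z₀ ∂ν) * φ z ∂μ = ∫ z₀, f₀ z₀ * ∫ z, k z z₀ * φ z ∂μ ∂ν := by
  have hint : Integrable (fun p : E × F => k p.1 p.2 * f₀ p.2 * φ p.1) (μ.prod ν) :=
    (integrable_mixture hk h0 h1 hf₀).mul_bdd (c := K)
      (hφ.comp measurable_fst).aestronglyMeasurable (ae_of_all _ fun p => hK p.1)
  calc _ = ∫ z, ∫ z₀, k z z₀ * f₀ z₀ * φ z ∂ν ∂μ := by simp only [integral_mul_const]
    _ = ∫ z₀, ∫ z, k z z₀ * f₀ z₀ * φ z ∂μ ∂ν := integral_integral_swap hint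
    _ = _ := by
      refine integral_congr_ae (ae_of_all _ fun z₀ => ?_)
      simp only [← integral_const_mul]
      exact integral_congr_ae (ae_of_all _ fun z => by ring)

end Mixtures

/-! ### Kernel representation of both solutions -/

section Representation

variable {d : ℕ}

local notation "V" => EuclideanSpace ℝ (Fin d)

lemma one_sub_exp_neg_sq_pos {t : ℝ} (ht : 0 < t) : 0 < 1 - Real.exp (-t) ^ 2 := by
  have h1 : Real.exp (-t) < 1 := Real.exp_zero ▸ Real.exp_lt_exp.2 (by linarith)
  nlinarith [Real.exp_pos (-t)]

lemma sub_two_mul_halfTanh_pos {t : ℝ} (ht : 0 < t) : 0 < 2 * (t - 2 * halfTanh t) := by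
  obtain ⟨κ, hκ, -, h⟩ := exists_mul_le_sub_two_mul_halfTanh ht
  have := h t le_rfl
  have := mul_pos hκ ht
  linarith

lemma continuous_kfpKernel (t : ℝ) : Continuous (kfpKernel (d := d) t).uncurry := by
  simp only [Function.uncurry_def, kfpKernel]
  fun_prop

lemma continuous_heatMaxwellKernel (t : ℝ) :
    Continuous (heatMaxwellKernel (d := d) t).uncurry := by
  simp only [Function.uncurry_def, heatMaxwellKernel]
  fun_prop

variable {t : ℝ}

lemma kfpKernel_nonneg (ht : 0 < t) (z z₀ : V × V) : 0 ≤ kfpKernel t z z₀ :=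
  mul_nonneg (gaussianDensity_nonneg _ (one_sub_exp_neg_sq_pos ht))
    (gaussianDensity_nonneg _ (sub_two_mul_halfTanh_pos ht))

lemma heatMaxwellKernel_nonneg (ht : 0 < t) (z z₀ : V × V) : 0 ≤ heatMaxwellKernel t z z₀ :=
  mul_nonneg (gaussianDensity_nonneg _ (by linarith)) (gaussianDensity_nonneg _ one_pos)

lemma lintegral_kfpKernel (ht : 0 < t) (z₀ : V × V) :
    ∫⁻ z, ENNReal.ofReal (kfpKernel t z z₀) = 1 := by
  have hm : Measurable fun z => ENNReal.ofReal (kfpKernel t z z₀) :=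
    (((continuous_kfpKernel t).comp (Continuous.prodMk_left z₀)).measurable).ennreal_ofReal
  rw [Measure.volume_eq_prod, lintegral_prod_symm' _ hm]
  simp only [kfpKernel, ENNReal.ofReal_mul (gaussianDensity_nonneg _ (one_sub_exp_neg_sq_pos ht)),
    sub_sub _ z₀.1]
  simp only [lintegral_const_mul' _ _ ENNReal.ofReal_ne_top,
    lintegral_gaussianDensity_sub _ (sub_two_mul_halfTanh_pos ht), mul_one,
    lintegral_gaussianDensity_sub _ (one_sub_exp_neg_sq_pos ht)]

lemma lintegral_heatMaxwellKernel (ht : 0 < t) (z₀ : V × V) :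
    ∫⁻ z, ENNReal.ofReal (heatMaxwellKernel t z z₀) = 1 := by
  have hm : Measurable fun z => ENNReal.ofReal (heatMaxwellKernel t z z₀) :=
    (((continuous_heatMaxwellKernel t).comp (Continuous.prodMk_left z₀)).measurable).ennreal_ofReal
  have h2t : 0 < 2 * t := by linarith
  rw [Measure.volume_eq_prod, lintegral_prod _ hm.aemeasurable]
  simp only [heatMaxwellKernel, ENNReal.ofReal_mul (gaussianDensity_nonneg _ h2t)]
  simp only [lintegral_const_mul' _ _ ENNReal.ofReal_ne_top, lintegral_gaussianDensity one_pos,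
    mul_one, lintegral_gaussianDensity_sub _ h2t]

lemma integrable_of_lintegral_ofReal_eq_one {α : Type*} [MeasurableSpace α] {μ : Measure α}
    {k : α → ℝ} (hk : Measurable k) (h0 : ∀ z, 0 ≤ k z)
    (h1 : ∫⁻ z, ENNReal.ofReal (k z) ∂μ = 1) : Integrable k μ := by
  refine ⟨hk.aestronglyMeasurable, ?_⟩
  rw [hasFiniteIntegral_iff_ofReal (ae_of_all _ h0), h1]
  exact ENNReal.one_lt_top

lemma integrable_mul_cos {α : Type*} [MeasurableSpace α] {μ : Measure α}
    {g h : α → ℝ} (hg : Integrable g μ) (hh : Measurable h) :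
    Integrable (fun z => g z * Real.cos (h z)) μ :=
  hg.mul_bdd (c := 1) hh.cos.aestronglyMeasurable (ae_of_all _ fun _ => Real.abs_cos_le_one _)

/-- Position is integrated first: its conditional mean is affine in the velocity, so this only tilts
the velocity frequency from `η` to `η + halfTanh t • ξ`, and a second Gaussian integral remains. The
outcome has the multiplier and transported frequency of `IsKFPSolution.integral_mul_cos`, which
identifies `kfpKernel`. -/
lemma integral_kfpKernel_mul_cos (ht : 0 < t) (z₀ : V × V) (ξ η : V) (θ : ℝ) :
    ∫ z, kfpKernel t z z₀ * Real.cos (inner ℝ ξ z.1 + inner ℝ η z.2 + θ) =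
      Real.exp (-(t * ‖ξ‖ ^ 2 + 2 * inner ℝ ξ (η - ξ) * (1 - Real.exp (-t)) +
        ‖η - ξ‖ ^ 2 * (1 - Real.exp (-t) ^ 2) / 2)) *
      Real.cos (inner ℝ ξ z₀.1 + inner ℝ (ξ + Real.exp (-t) • (η - ξ)) z₀.2 + θ) := by
  have hint := integrable_mul_cos (h := fun z : V × V => inner ℝ ξ z.1 + inner ℝ η z.2 + θ)
    (integrable_of_lintegral_ofReal_eq_one
    ((continuous_kfpKernel t).comp (Continuous.prodMk_left z₀)).measurable
    (fun z => kfpKernel_nonneg ht z z₀) (lintegral_kfpKernel ht z₀))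
    (Continuous.measurable (by fun_prop))
  simp only [Function.comp_apply, Function.uncurry_apply_pair] at hint
  rw [Measure.volume_eq_prod] at hint ⊢
  rw [integral_prod_symm _ hint]
  have hinner : ∀ v : V, ∫ x, kfpKernel t (x, v) z₀ * Real.cos (inner ℝ ξ x + inner ℝ η v + θ) =
      Real.exp (-(2 * (t - 2 * halfTanh t) * ‖ξ‖ ^ 2 / 2)) *
        (gaussianDensity (1 - Real.exp (-t) ^ 2) (v - Real.exp (-t) • z₀.2) *
        Real.cos (inner ℝ (η + halfTanh t • ξ) v +
          (inner ℝ ξ (z₀.1 + halfTanh t • z₀.2) + θ))) := fun v => by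
    simp only [kfpKernel, sub_sub _ z₀.1, mul_assoc (gaussianDensity (1 - Real.exp (-t) ^ 2) _),
      integral_const_mul, add_assoc (inner ℝ ξ _) (inner ℝ η v)]
    rw [integral_gaussianDensity_mul_cos _ _ (sub_two_mul_halfTanh_pos ht)]
    rw [mul_left_comm]
    congr 3
    simp only [inner_add_left, inner_add_right, inner_smul_left, inner_smul_right,
      RCLike.conj_to_real]
    ring
  simp only [hinner, integral_const_mul]
  rw [integral_gaussianDensity_mul_cos _ _ (one_sub_exp_neg_sq_pos ht), ← mul_assoc,
    ← Real.exp_add]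
  have hq : 1 + Real.exp (-t) ≠ 0 := by linarith [Real.exp_pos (-t)]
  -- Both identities, for the exponent and for the phase, are rational in $e^{-t}$ and rest on
  -- $(1+e^{-t})\tanh(t/2)=1-e^{-t}$.
  congr 2
  · rw [norm_add_sq_real, norm_sub_sq_real, norm_smul, inner_smul_right, inner_sub_right,
      real_inner_self_eq_norm_sq, mul_pow, Real.norm_eq_abs, sq_abs, real_inner_comm ξ η, halfTanh]
    field_simp
    ring
  · simp only [inner_add_left, inner_add_right, inner_smul_left, inner_smul_right, inner_sub_left,
      RCLike.conj_to_real, halfTanh]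
    field_simp
    ring

lemma integral_heatMaxwellKernel_mul_cos (ht : 0 < t) (z₀ : V × V) (ξ η : V) (θ : ℝ) :
    ∫ z, heatMaxwellKernel t z z₀ * Real.cos (inner ℝ ξ z.1 + inner ℝ η z.2 + θ) =
      Real.exp (-(‖η‖ ^ 2 / 2)) * (Real.exp (-(t * ‖ξ‖ ^ 2)) *
      Real.cos (inner ℝ ξ z₀.1 + θ)) := by
  have hint := integrable_mul_cos (h := fun z : V × V => inner ℝ ξ z.1 + inner ℝ η z.2 + θ)
    (integrable_of_lintegral_ofReal_eq_one
    ((continuous_heatMaxwellKernel t).comp (Continuous.prodMk_left z₀)).measurable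
    (fun z => heatMaxwellKernel_nonneg ht z z₀) (lintegral_heatMaxwellKernel ht z₀))
    (Continuous.measurable (by fun_prop))
  simp only [Function.comp_apply, Function.uncurry_apply_pair] at hint
  rw [Measure.volume_eq_prod] at hint ⊢
  rw [integral_prod _ hint]
  have h1 := fun (x : V) => integral_gaussianDensity_mul_cos 0 η one_pos (inner ℝ ξ x + θ)
  simp only [sub_zero, inner_zero_right, zero_add, one_mul] at h1
  simp only [heatMaxwellKernel, mul_assoc, integral_const_mul]
  have h2 : ∀ x y : V, inner ℝ ξ x + inner ℝ η y + θ = inner ℝ η y + (inner ℝ ξ x + θ) :=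
    fun x y => by ring
  simp only [h2, h1, mul_left_comm _ (Real.exp (-(‖η‖ ^ 2 / 2))), integral_const_mul,
    integral_gaussianDensity_mul_cos z₀.1 ξ (mul_pos two_pos ht)]
  congr 4
  ring

lemma exists_inner_add_inner_eq (l : V × V →L[ℝ] ℝ) :
    ∃ ξ η : V, ∀ z, l z = inner ℝ ξ z.1 + inner ℝ η z.2 := by
  refine ⟨(InnerProductSpace.toDual ℝ V).symm (l.comp (ContinuousLinearMap.inl ℝ V V)),
    (InnerProductSpace.toDual ℝ V).symm (l.comp (ContinuousLinearMap.inr ℝ V V)), fun z => ?_⟩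
  simp only [InnerProductSpace.toDual_symm_apply, ContinuousLinearMap.comp_apply,
    ContinuousLinearMap.inl_apply, ContinuousLinearMap.inr_apply]
  rw [← map_add]
  simp

/-- Both solutions are given by their kernels. -/
theorem sub_maxwellian_ae_eq_integral_kernel {f₀ : V × V → ℝ} {f : ℝ → V × V → ℝ}
    {u : ℝ → V → ℝ} (hf₀ : Integrable f₀) (hf : IsKFPSolution f₀ f)
    (hu : IsHeatSolution (fun x => ∫ w, f₀ (x, w)) u) (ht : 0 < t) :
    (fun z : V × V => f t z - u t z.1 * maxwellian z.2) =ᵐ[volume]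
      fun z => ∫ z₀, (kfpKernel t z z₀ - heatMaxwellKernel t z z₀) * f₀ z₀ := by
  have hft := hf.curve.integrable t ht.le
  have hut := hu.curve.integrable t ht.le
  have hkm := (continuous_kfpKernel (d := d) t).measurable
  have hhm := (continuous_heatMaxwellKernel (d := d) t).measurable
  have hK := integrable_mixture (μ := volume) hkm (kfpKernel_nonneg ht) (lintegral_kfpKernel ht) hf₀
  have hH := integrable_mixture (μ := volume) hhm (heatMaxwellKernel_nonneg ht)
    (lintegral_heatMaxwellKernel ht) hf₀
  have huM : Integrable (fun z : V × V => u t z.1 * gaussianDensity 1 z.2) :=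
    hut.mul_prod (integrable_gaussianDensity one_pos)
  have hu₀ : Integrable fun x => ∫ w, f₀ (x, w) := hf₀.integral_prod_left
  have hzero := ae_eq_zero_of_forall_integral_mul_cos_eq_zero (μ := (volume : Measure (V × V)))
    (h := fun z => (f t z - u t z.1 * gaussianDensity 1 z.2) -
      ((∫ z₀, kfpKernel t z z₀ * f₀ z₀) - ∫ z₀, heatMaxwellKernel t z z₀ * f₀ z₀))
    ((hft.sub huM).sub (hK.integral_prod_left.sub hH.integral_prod_left)) fun l θ => by
      obtain ⟨ξ, η, hl⟩ := exists_inner_add_inner_eq l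
      have hm : Measurable fun z : V × V => inner ℝ ξ z.1 + inner ℝ η z.2 + θ :=
        Continuous.measurable (by fun_prop)
      have e1 := hf.integral_mul_cos hf₀ ξ η θ ht.le
      have e2 : ∫ z : V × V, u t z.1 * gaussianDensity 1 z.2 *
          Real.cos (inner ℝ ξ z.1 + inner ℝ η z.2 + θ) =
          Real.exp (-(‖η‖ ^ 2 / 2)) * (Real.exp (-(t * ‖ξ‖ ^ 2)) *
            ∫ z, f₀ z * Real.cos (inner ℝ ξ z.1 + θ)) := by
        have h1 := fun (x : V) => integral_gaussianDensity_mul_cos 0 η one_pos (inner ℝ ξ x + θ)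
        simp only [sub_zero, inner_zero_right, zero_add, one_mul] at h1
        have h2 : ∀ x y : V, inner ℝ ξ x + inner ℝ η y + θ = inner ℝ η y + (inner ℝ ξ x + θ) :=
          fun x y => by ring
        have h3 := integrable_mul_cos huM hm
        have h4 := integrable_mul_cos (h := fun z : V × V => inner ℝ ξ z.1 + θ) hf₀
          (Continuous.measurable (by fun_prop))
        rw [Measure.volume_eq_prod] at h3 h4 ⊢
        rw [integral_prod _ h3, integral_prod _ h4]
        simp only [mul_assoc, integral_const_mul, h2, h1,
          mul_left_comm _ (Real.exp (-(‖η‖ ^ 2 / 2))), integral_mul_const]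
        rw [hu.integral_mul_cos hu₀ ξ θ ht.le]
      have hcos : ∀ z : V × V, |Real.cos (inner ℝ ξ z.1 + inner ℝ η z.2 + θ)| ≤ 1 := fun _ =>
        Real.abs_cos_le_one _
      have e3 := integral_mixture_mul (μ := volume) hkm (kfpKernel_nonneg ht)
        (lintegral_kfpKernel ht) hf₀ hm.cos hcos
      have e4 := integral_mixture_mul (μ := volume) hhm (heatMaxwellKernel_nonneg ht)
        (lintegral_heatMaxwellKernel ht) hf₀ hm.cos hcos
      simp only [integral_kfpKernel_mul_cos ht, mul_left_comm _ (Real.exp _),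
        integral_const_mul] at e3
      simp only [integral_heatMaxwellKernel_mul_cos ht,
        ← mul_assoc (Real.exp (-(‖η‖ ^ 2 / 2))),
        mul_left_comm _ (Real.exp (-(‖η‖ ^ 2 / 2)) * Real.exp (-(t * ‖ξ‖ ^ 2))),
        integral_const_mul] at e4
      rw [← mul_assoc] at e2
      simp only [hl, sub_mul]
      rw [integral_sub, integral_sub, integral_sub, e1, e2, e3, e4, sub_self]
      · exact integrable_mul_cos hK.integral_prod_left hm
      · exact integrable_mul_cos hH.integral_prod_left hm
      · exact integrable_mul_cos hft hm
      · exact integrable_mul_cos huM hm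
      · exact (integrable_mul_cos hft hm).sub (integrable_mul_cos huM hm)
      · exact (integrable_mul_cos hK.integral_prod_left hm).sub
          (integrable_mul_cos hH.integral_prod_left hm)
  filter_upwards [hzero, hK.prod_right_ae, hH.prod_right_ae] with z hz hKz hHz
  simp only [sub_mul, maxwellian_eq_gaussianDensity]
  rw [integral_sub hKz hHz]
  exact sub_eq_zero.1 hz

end Representation

/-! ### Averaging over the initial datum and interpolation -/

section MainEstimate

variable {d : ℕ}

local notation "V" => EuclideanSpace ℝ (Fin d)

/-- A bound that is affine in the initial velocity integrates against the initial datum. -/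
lemma lintegral_enorm_mul_le {f₀ : V × V → ℝ} (hf₀ : IsProbabilityDensity f₀) {M₁ : ℝ≥0}
    (hM : ∫⁻ z, ENNReal.ofReal (f₀ z * ‖z.2‖) ≤ (M₁ : ℝ≥0∞)) {D : ℝ} (hD : 0 ≤ D)
    {h : V × V → ℝ≥0∞} (hh : ∀ z₀, h z₀ ≤ ENNReal.ofReal (D * (1 + ‖z₀.2‖))) :
    ∫⁻ z₀, h z₀ * ‖f₀ z₀‖ₑ ≤ ENNReal.ofReal (D * (1 + M₁)) := by
  have h1 : ∫⁻ z, ENNReal.ofReal (f₀ z) = 1 := by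
    rw [← ofReal_integral_eq_lintegral_ofReal hf₀.integrable hf₀.nonneg, hf₀.integral_eq_one,
      ENNReal.ofReal_one]
  have hm : AEMeasurable (fun z => ENNReal.ofReal (f₀ z)) (volume : Measure (V × V)) :=
    hf₀.integrable.aestronglyMeasurable.aemeasurable.ennreal_ofReal
  calc ∫⁻ z₀, h z₀ * ‖f₀ z₀‖ₑ
      ≤ ∫⁻ z₀, ENNReal.ofReal D * (ENNReal.ofReal (f₀ z₀) + ENNReal.ofReal (f₀ z₀ * ‖z₀.2‖)) := by
        refine lintegral_mono_ae ?_
        filter_upwards [hf₀.nonneg] with z₀ hz₀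
        rw [← ENNReal.ofReal_add hz₀ (by positivity), ← ENNReal.ofReal_mul hD,
          Real.enorm_of_nonneg hz₀]
        refine (mul_le_mul_left (hh z₀) _).trans_eq ?_
        rw [← ENNReal.ofReal_mul (by positivity)]
        congr 1
        ring
    _ ≤ ENNReal.ofReal D * (1 + M₁) := by
        rw [lintegral_const_mul' _ _ ENNReal.ofReal_ne_top, lintegral_add_left' hm, h1]
        gcongr
    _ = _ := by
        rw [ENNReal.ofReal_mul hD, ENNReal.ofReal_add zero_le_one M₁.coe_nonneg,
          ENNReal.ofReal_one, ENNReal.ofReal_coe_nnreal]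

/-- The velocity norm of `g` is dominated by the average `F` over `z₀` of the velocity norms of the
kernel. The two endpoint bounds pass to `F` by Tonelli, with $1+|w|$ averaging to at most $1+M_1$;
interpolation is applied once, to `F`. -/
lemma mixedNorm_one_le_of_ae_eq_integral_kernel {f₀ g : V × V → ℝ} {K : V × V → V × V → ℝ}
    (hK : Continuous K.uncurry) (hf₀ : IsProbabilityDensity f₀)
    (hg : g =ᵐ[volume] fun z => ∫ z₀, K z z₀ * f₀ z₀) {M₁ : ℝ≥0}
    (hM : ∫⁻ z, ENNReal.ofReal (f₀ z * ‖z.2‖) ≤ (M₁ : ℝ≥0∞)) {D S : ℝ} (hD : 0 < D) (hS : 0 < S)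
    (hsup : ∀ z₀ x, ∫⁻ v, ‖K (x, v) z₀‖ₑ ≤ ENNReal.ofReal (D * (1 + ‖z₀.2‖) * S))
    (hint : ∀ z₀, ∫⁻ x, ∫⁻ v, ‖K (x, v) z₀‖ₑ ≤ ENNReal.ofReal (D * (1 + ‖z₀.2‖)))
    {p : ℝ≥0∞} (hp : 1 ≤ p) :
    mixedNorm p 1 g ≤ ENNReal.ofReal (D * (1 + M₁) * S ^ (1 - (p⁻¹).toReal)) := by
  have hfm : AEMeasurable (fun z => ‖f₀ z‖ₑ) (volume : Measure (V × V)) :=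
    hf₀.integrable.aestronglyMeasurable.enorm
  have hKm : ∀ x, Measurable fun q : V × (V × V) => ‖K (x, q.1) q.2‖ₑ := fun x =>
    (hK.comp (by fun_prop : Continuous fun q : V × (V × V) => ((x, q.1), q.2))).measurable.enorm
  have hKm' : Measurable fun q : V × (V × V) => ∫⁻ v, ‖K (q.1, v) q.2‖ₑ := by
    have : Measurable fun r : (V × (V × V)) × V => ‖K (r.1.1, r.2) r.1.2‖ₑ :=
      (hK.comp (by fun_prop : Continuous fun r : (V × (V × V)) × V =>
        ((r.1.1, r.2), r.1.2))).measurable.enorm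
    exact this.lintegral_prod_right'
  let F : V → ℝ≥0∞ := fun x => ∫⁻ z₀, (∫⁻ v, ‖K (x, v) z₀‖ₑ) * ‖f₀ z₀‖ₑ
  have hF1 : ∀ x, F x ≤ ENNReal.ofReal (D * (1 + M₁) * S) := fun x => by
    have := lintegral_enorm_mul_le hf₀ hM (D := D * S) (by positivity)
      (h := fun z₀ => ∫⁻ v, ‖K (x, v) z₀‖ₑ) fun z₀ => (hsup z₀ x).trans_eq (by ring_nf)
    exact this.trans_eq (by ring_nf)
  have hF2 : ∫⁻ x, F x ≤ ENNReal.ofReal (D * (1 + M₁)) := by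
    simp only [F]
    rw [lintegral_lintegral_swap (hKm'.aemeasurable.mul hfm.comp_snd)]
    simp only [lintegral_mul_const' _ _ enorm_ne_top]
    exact lintegral_enorm_mul_le hf₀ hM hD.le hint
  refine le_trans ?_ (eLpNorm_le_of_le_of_lintegral_le (by positivity) hS hp hF1 hF2)
  rw [Measure.volume_eq_prod] at hg
  refine eLpNorm_mono_enorm_ae ?_
  filter_upwards [Measure.ae_ae_of_ae_prod hg] with x hx
  rw [enorm_eq_self, enorm_eq_self, eLpNorm_congr_ae hx, eLpNorm_one_eq_lintegral_enorm]
  simp only [F]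
  calc ∫⁻ v, ‖∫ z₀, K (x, v) z₀ * f₀ z₀‖ₑ ≤ ∫⁻ v, ∫⁻ z₀, ‖K (x, v) z₀‖ₑ * ‖f₀ z₀‖ₑ :=
        lintegral_mono fun v => by
          simpa only [enorm_mul] using enorm_integral_le_lintegral_enorm
            fun z₀ => K (x, v) z₀ * f₀ z₀
    _ = ∫⁻ z₀, ∫⁻ v, ‖K (x, v) z₀‖ₑ * ‖f₀ z₀‖ₑ :=
        lintegral_lintegral_swap ((hKm x).aemeasurable.mul hfm.comp_snd)
    _ = _ := by simp only [lintegral_mul_const' _ _ enorm_ne_top]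

end MainEstimate

theorem mainTheorem4 (d : ℕ) (p : ℝ≥0∞) (hp : 1 ≤ p) (N M₁ : ℝ≥0) (t₀ : ℝ) (ht₀ : 0 < t₀) :
    ∃ C : ℝ, 0 < C ∧
      ∀ (f₀ : EuclideanSpace ℝ (Fin d) × EuclideanSpace ℝ (Fin d) → ℝ)
        (f : ℝ → EuclideanSpace ℝ (Fin d) × EuclideanSpace ℝ (Fin d) → ℝ)
        (u : ℝ → EuclideanSpace ℝ (Fin d) → ℝ),
        IsProbabilityDensity f₀ →
        MemLp f₀ p volume →
        eLpNorm f₀ p volume ≤ (N : ℝ≥0∞) →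
        ∫⁻ z, ENNReal.ofReal (f₀ z * ‖z.2‖) ≤ (M₁ : ℝ≥0∞) →
        IsKFPSolution f₀ f →
        IsHeatSolution (fun x => ∫ w, f₀ (x, w)) u →
        ∀ t, t₀ ≤ t →
          mixedNorm p 1 (fun z => f t z - u t z.1 * maxwellian z.2) ≤
            ENNReal.ofReal
              (C * t ^ (-((d : ℝ) / 2) * (1 - (p⁻¹).toReal)) * t ^ (-(1 / 2) : ℝ)) := by
  obtain ⟨C, hC, hker⟩ := exists_lintegral_kernel_sub_le (d := d) ht₀
  refine ⟨C * (1 + M₁), by positivity, fun f₀ f u hf₀ _ _ hM hf hu t ht => ?_⟩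
  have htpos : 0 < t := ht₀.trans_le ht
  have hst : 0 < √t := Real.sqrt_pos.2 htpos
  refine (mixedNorm_one_le_of_ae_eq_integral_kernel
    (K := fun z z₀ => kfpKernel t z z₀ - heatMaxwellKernel t z z₀)
    (D := C / √t) (S := t ^ (-(d : ℝ) / 2))
    ((continuous_kfpKernel t).sub (continuous_heatMaxwellKernel t)) hf₀
    (sub_maxwellian_ae_eq_integral_kernel hf₀.integrable hf hu htpos) hM (by positivity)
    (by positivity) (fun z₀ x => ((hker t ht z₀).1 x).trans_eq (by rw [mul_div_right_comm]))
    (fun z₀ => (hker t ht z₀).2.trans_eq (by rw [mul_div_right_comm])) hp).trans_eq ?_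
  rw [← Real.rpow_mul htpos.le, Real.rpow_neg htpos.le (1 / 2), ← Real.sqrt_eq_rpow, neg_div]
  congr 1
  ring
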